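/- **Setting.** Let $(\mathcal X,d,\mu)$ be a space of homogeneous type: $d$ is a distance on $\mathcal X$ and $\mu$ is a Borel measure with $\mu(B(x,2r))\le C_0\,\mu(B(x,r))<\infty$ for all $x\in\mathcal X$, $r>0$, where $B(x,r)=\{y: d(x,y)<r\}$. For a ball $B=B(x,r)$ put $\lambda B=B(x,\lambda r)$, and $C_j(B)=2^{j+1}B\setminus 2^jB$ for $j\ge 2$. Write $$\Big(-\!\!\!\!\!\int_B|h|^s\,d\mu\Big)^{1/s}=\Big(\tfrac1{\mu(B)}\int_B|h|^s\,d\mu\Big)^{1/s},\qquad \Big(-\!\!\!\!\!\int_{C_j(B)}|h|^s\,d\mu\Big)^{1/s}=\Big(\tfrac1{\mu(2^{j+1}B)}\int_{C_j(B)}|h|^s\,d\mu\Big)^{1/s},$$ to be read as essential suprema over $B$ and $C_j(B)$ when $s=\infty$. Let $\Upsilon(s)=\max\{s,s^{-1}\}$ for $s>0$, and let $\chi_E$ be the indicator function of $E$. Let $\mathbb B$ be a complex Banach space of $\mu$-measurable complex functions (modulo equality a.e.) that is stable under truncation by indicator functions of measurable sets, contains the indicator functions of all measurable sets of finite measure,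 and in which norm convergence implies convergence in measure on every ball. *Off-diagonal estimates.* Let $1\le p\le q\le\infty$. A family $\{S_i\}_{i\in I}$ of bounded linear operators on $\mathbb B$ with times $t_i>0$ belongs to $\mathcal O(L^p-L^q)$ if there are constants $\theta_1,\theta_2,c,C>0$ such that for every $i\in I$ (with $t=t_i$), every ball $B$ of radius $r$ and every $f\in\mathbb B\cap L^p(\mu)$, $$\Big(-\!\!\!\!\!\int_B|S_i(\chi_Bf)|^q\,d\mu\Big)^{1/q}\le C\,\Upsilon\Big(\frac r{\sqrt t}\Big)^{\theta_2}\Big(-\!\!\!\!\!\int_B|f|^p\,d\mu\Big)^{1/p},$$ and for all integers $j\ge2$ $$\Big(-\!\!\!\!\!\int_B|S_i(\chi_{C_j(B)}f)|^q\,d\mu\Big)^{1/q}\le C\,2^{j\theta_1}\Upsilon\Big(\frac{2^jr}{\sqrt t}\Big)^{\theta_2}e^{-c4^jr^2/t}\Big(-\!\!\!\!\!\int_{C_j(B)}|f|^p\,d\mu\Big)^{1/p},$$ $$\Big(-\!\!\!\!\!\int_{C_j(B)}|S_i(\chi_Bf)|^q\,d\mu\Big)^{1/q}\le C\,2^{j\theta_1}\Upsilon\Big(\frac{2^jr}{\sqrt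 t}\Big)^{\theta_2}e^{-c4^jr^2/t}\Big(-\!\!\!\!\!\int_B|f|^p\,d\mu\Big)^{1/p}.$$ The time of $T_t$ is $t$ for a family indexed by $t>0$; for a family indexed by complex numbers $z$ in a sector, the time is $|z|$. For $\vartheta<\pi/2$ let $\Sigma_\vartheta=\{\zeta\in\mathbb C\setminus\{0\}:|\arg\zeta|<\vartheta\}$, and let $\{T_z\}_{z\in\Sigma_\vartheta}$ be an analytic semigroup of bounded linear operators on $\mathbb B$: $T_z\in\mathcal L(\mathbb B)$, $T_z\circ T_{z'}=T_{z+z'}$ for $z,z'\in\Sigma_\vartheta$, and $z\mapsto T_z\in\mathcal L(\mathbb B)$ is analytic in operator norm on $\Sigma_\vartheta$. **Theorem.** Let $1\le p\le p_0\le q\le\infty$ and $0\le\vartheta_1<\vartheta<\pi/2$. Assume that each $T_z$, $z\in\Sigma_\vartheta$, is determined by its action on functions of bounded support in the following sense: for all $f\in\mathbb B\cap L^p(\mu)\cap L^{p_0}(\mu)$ and $x\in\mathcal X$, $T_z(\chi_{B(x,n)}f)\to T_zf$ in measure on every ball as $n\to\infty$. Assume that $\{T_t\}_{t>0}\in\mathcal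 O(L^p-L^q)$ and that $\{T_z\}_{z\in\Sigma_\vartheta}\in\mathcal O(L^{p_0}-L^{p_0})$. Then for every integer $m\ge0$, $$\Big\{z^m\frac{d^mT_z}{dz^m}\Big\}_{z\in\Sigma_{\vartheta_1}}\in\mathcal O(L^p-L^q).$$ -/

import Mathlib

open MeasureTheory Metric Set Filter Topology
open scoped ENNReal NNReal

namespace OffDiagonal

/-- `(X, d, μ)` is a space of homogeneous type:
`μ(B(x, 2r)) ≤ C₀ μ(B(x, r)) < ∞` for all `x` and all `r > 0`. -/
def IsHomogeneousType {X : Type*} [MetricSpace X] [MeasurableSpace X] (μ : Measure X) : Prop :=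
  ∃ C₀ : ℝ≥0, ∀ (x : X) (r : ℝ), 0 < r →
    μ (ball x (2 * r)) ≤ C₀ * μ (ball x r) ∧ μ (ball x r) < ∞

/-- The structure, on a Banach space `𝔹`, of a Banach space of (classes modulo a.e. equality of)
complex measurable functions: a linear injection into the measurable functions such that `𝔹` is
stable under truncation by indicators of measurable sets, contains the simple functions
(linear combinations of indicators of sets of finite measure), and norm convergence implies
convergence in measure on every ball. -/
structure BanachFunctionSpace {X : Type*} [MetricSpace X] [MeasurableSpace X] (μ : Measure X)
    (𝔹 : Type*) [NormedAddCommGroup 𝔹] [NormedSpace ℂ 𝔹] where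
  /-- The measurable function represented by an element of `𝔹`. -/
  toFun : 𝔹 →ₗ[ℂ] (X →ₘ[μ] ℂ)
  injective : Function.Injective toFun
  exists_truncation : ∀ (E : Set X), MeasurableSet E → ∀ f : 𝔹, ∃ g : 𝔹,
    (toFun g : X → ℂ) =ᵐ[μ] E.indicator (toFun f : X → ℂ)
  exists_indicator : ∀ (E : Set X), MeasurableSet E → μ E < ∞ → ∃ g : 𝔹,
    (toFun g : X → ℂ) =ᵐ[μ] E.indicator (fun _ => (1 : ℂ))
  tendstoInMeasure : ∀ (u : ℕ → 𝔹) (f : 𝔹), Tendsto u atTop (𝓝 f) → ∀ (x : X) (r : ℝ),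
    TendstoInMeasure (μ.restrict (ball x r)) (fun n => (toFun (u n) : X → ℂ)) atTop
      (toFun f : X → ℂ)

section

variable {X : Type*} [MetricSpace X] [MeasurableSpace X] {μ : Measure X}
  {𝔹 : Type*} [NormedAddCommGroup 𝔹] [NormedSpace ℂ 𝔹]

open Classical in
/-- The truncation `χ_E f` as an element of `𝔹` (for measurable `E`). -/
noncomputable def BanachFunctionSpace.trunc (S : BanachFunctionSpace μ 𝔹) (E : Set X) (f : 𝔹) :
    𝔹 :=
  if hE : MeasurableSet E then (S.exists_truncation E hE f).choose else 0

theorem BanachFunctionSpace.trunc_ae_eq (S : BanachFunctionSpace μ 𝔹) {E : Set X}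
    (hE : MeasurableSet E) (f : 𝔹) :
    (S.toFun (S.trunc E f) : X → ℂ) =ᵐ[μ] E.indicator (S.toFun f : X → ℂ) := by
  unfold BanachFunctionSpace.trunc
  rw [dif_pos hE]
  exact (S.exists_truncation E hE f).choose_spec

/-- The annulus `C_j(B) = 2^{j+1} B \ 2^j B` of the ball `B = B(x, r)` (used for `j ≥ 2`). -/
def annulus (x : X) (r : ℝ) (j : ℕ) : Set X :=
  ball x (2 ^ (j + 1) * r) \ ball x (2 ^ j * r)

/-- The averaged norm `(μ(V)⁻¹ ∫_E |h|^p dμ)^{1/p}`, the essential supremum over `E` if `p = ∞`. -/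
noncomputable def avgNorm (μ : Measure X) (V E : Set X) (p : ℝ≥0∞) (h : X → ℂ) : ℝ≥0∞ :=
  eLpNorm h p ((μ V)⁻¹ • μ.restrict E)

/-- The average over the ball `B = B(x, r)`, normalised by `μ(B)`. -/
noncomputable def ballAvg (μ : Measure X) (x : X) (r : ℝ) (p : ℝ≥0∞) (h : X → ℂ) : ℝ≥0∞ :=
  avgNorm μ (ball x r) (ball x r) p h

/-- The average over `C_j(B)`, normalised by `μ(2^{j+1} B)`. -/
noncomputable def annulusAvg (μ : Measure X) (x : X) (r : ℝ) (j : ℕ) (p : ℝ≥0∞) (h : X → ℂ) :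
    ℝ≥0∞ :=
  avgNorm μ (ball x (2 ^ (j + 1) * r)) (annulus x r j) p h

/-- `Υ(s) = max {s, s⁻¹}`. -/
noncomputable def upsilon (s : ℝ) : ℝ := max s s⁻¹

/-- The `L^p - L^q` off-diagonal estimates on balls for a family `(T i)` of operators on `𝔹`,
where `τ i > 0` is the time of `T i`; they concern the functions `f ∈ 𝔹 ∩ L^p(μ)`. -/
def OffDiag (S : BanachFunctionSpace μ 𝔹) (p q : ℝ≥0∞) {I : Type*} (τ : I → ℝ)
    (T : I → 𝔹 →L[ℂ] 𝔹) : Prop :=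
  ∃ θ₁ θ₂ c C : ℝ, 0 < θ₁ ∧ 0 < θ₂ ∧ 0 < c ∧ 0 < C ∧
    ∀ (i : I) (x : X) (r : ℝ), 0 < r → ∀ f : 𝔹, MemLp (S.toFun f : X → ℂ) p μ →
      ballAvg μ x r q (S.toFun (T i (S.trunc (ball x r) f))) ≤
          ENNReal.ofReal (C * upsilon (r / √(τ i)) ^ θ₂) * ballAvg μ x r p (S.toFun f) ∧
      ∀ j : ℕ, 2 ≤ j →
        ballAvg μ x r q (S.toFun (T i (S.trunc (annulus x r j) f))) ≤
            ENNReal.ofReal (C * ((2 : ℝ) ^ ((j : ℝ) * θ₁) *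
              upsilon (2 ^ j * r / √(τ i)) ^ θ₂ * Real.exp (-(c * 4 ^ j * r ^ 2 / τ i)))) *
              annulusAvg μ x r j p (S.toFun f) ∧
        annulusAvg μ x r j q (S.toFun (T i (S.trunc (ball x r) f))) ≤
            ENNReal.ofReal (C * ((2 : ℝ) ^ ((j : ℝ) * θ₁) *
              upsilon (2 ^ j * r / √(τ i)) ^ θ₂ * Real.exp (-(c * 4 ^ j * r ^ 2 / τ i)))) *
              ballAvg μ x r p (S.toFun f)

/-- The open sector `Σ_ϑ = {ζ ∈ ℂ \ {0} : |arg ζ| < ϑ}`. -/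
def sector (ϑ : ℝ) : Set ℂ := {ζ | ζ ≠ 0 ∧ |ζ.arg| < ϑ}

/-- `{T_t}_{t > 0}` satisfies the `L^p - L^q` off-diagonal estimates on balls. -/
def OffDiagReal (S : BanachFunctionSpace μ 𝔹) (p q : ℝ≥0∞) (T : ℂ → 𝔹 →L[ℂ] 𝔹) : Prop :=
  OffDiag S p q (fun t : Ioi (0 : ℝ) => (t : ℝ)) (fun t : Ioi (0 : ℝ) => T ((t : ℝ) : ℂ))

/-- `{T_z}_{z ∈ Σ_ϑ}` satisfies the `L^p - L^q` off-diagonal estimates on balls,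
with `|z|` in place of `t`. -/
def OffDiagSector (S : BanachFunctionSpace μ 𝔹) (p q : ℝ≥0∞) (ϑ : ℝ) (T : ℂ → 𝔹 →L[ℂ] 𝔹) :
    Prop :=
  OffDiag S p q (fun z : sector ϑ => ‖(z : ℂ)‖) (fun z : sector ϑ => T (z : ℂ))

/-- `{T_z}_{z ∈ Σ_ϑ}` is an analytic semigroup of bounded operators on `𝔹` (analyticity is with
respect to the operator norm; the values of `T` off the sector are irrelevant). -/
structure IsAnalyticSemigroup (ϑ : ℝ) (T : ℂ → 𝔹 →L[ℂ] 𝔹) : Prop where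
  comp : ∀ z ∈ sector ϑ, ∀ w ∈ sector ϑ, (T z).comp (T w) = T (z + w)
  analytic : AnalyticOnNhd ℂ T (sector ϑ)

/-- The bounded operator `A` on `𝔹` is continuous along the truncations of `f` to balls:
`A (χ_{B(x,n)} f) → A f` in measure on every ball, as `n → ∞`. -/
def TruncContinuousAt (S : BanachFunctionSpace μ 𝔹) (A : 𝔹 →L[ℂ] 𝔹) (f : 𝔹) : Prop :=
  ∀ (x y : X) (r : ℝ),
    TendstoInMeasure (μ.restrict (ball y r))
      (fun n : ℕ => (S.toFun (A (S.trunc (ball x (n : ℝ)) f)) : X → ℂ)) atTop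
      (S.toFun (A f) : X → ℂ)

end

end OffDiagonal

/-!
The proof replaces the off-diagonal estimates on balls of all radii by bounds at a single length
scale. For an operator `A` and a scale `ρ`, `GaussBound` asks that
`‖A (χ_{B(y, ρ)} f)‖` averaged in `L^q` over `B(x, ρ)` be at most `C exp (-c (d(x, y) / ρ)²)` times
the `L^p` average of `f` over `B(y, ρ)`, for all `x` and `y`. Because only Gaussian factors occur,
polynomial losses are harmless.

* With volume doubling, the off-diagonal estimates for a family with times `τ` are equivalent to
  uniform Gaussian bounds at scale `√τ` (`exists_gaussBound_of_offDiag`, `offDiag_of_gaussBound`).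
  In one direction a suitable annulus contains the target ball; in the other, sets are covered by
  balls of radius `ρ`, whose number grows polynomially.
* Gaussian bounds at comparable scales compose (`GaussBound.comp`). This is where the continuity
  of the operators along truncations enters: the intermediate function is integrable
  (`GaussBound.memLp`), is cut off to balls, and each cut-off is a finite sum of pieces.
* If `z` lies in the smaller sector and `ζ` is close to `z` relative to `‖z‖`, then
  `T_ζ = T_t T_w T_t` with `t > 0` and `w` in the larger sector, both comparable to `‖z‖`; the
  factors map `L^p → L^{p₀} → L^{p₀} → L^q`, so `T_ζ` has Gaussian bounds at scale `√‖z‖`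
  (`exists_gaussBound_near_sector`).
* For fixed constants the operators with Gaussian bounds form a closed convex set, so Cauchy's
  integral formula over a circle of radius proportional to `‖z‖` transfers the bounds to
  `z ^ m • T⁽ᵐ⁾(z)` (`GaussBound.iteratedDeriv`).

A measure of homogeneous type that vanishes on some ball is zero, and then there is nothing to
prove; otherwise all averages are taken over balls of positive finite measure.
-/

namespace OffDiagonal

/-! ### Averaged norms -/

section

variable {X : Type*} [MeasurableSpace X] {μ : Measure X}

theorem two_pow_mul_ofReal (n : ℕ) (a : ℝ) :
    (2 : ℝ≥0∞) ^ n * ENNReal.ofReal a = ENNReal.ofReal (2 ^ n * a) := by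
  rw [ENNReal.ofReal_mul (by positivity), ENNReal.ofReal_pow (by norm_num), ENNReal.ofReal_ofNat]

theorem avgNorm_congr_ae {V E : Set X} {p : ℝ≥0∞} {g h : X → ℂ} (hgh : g =ᵐ[μ] h) :
    avgNorm μ V E p g = avgNorm μ V E p h :=
  eLpNorm_congr_ae (Measure.ae_smul_measure (ae_restrict_of_ae hgh) _)

theorem aestronglyMeasurable_avg (g : X →ₘ[μ] ℂ) (c : ℝ≥0∞) (E : Set X) :
    AEStronglyMeasurable (g : X → ℂ) (c • μ.restrict E) :=
  (g.aestronglyMeasurable.mono_measure Measure.restrict_le_self).smul_measure c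

theorem avgNorm_add_le {V E : Set X} {p : ℝ≥0∞} (hp : 1 ≤ p) (g h : X →ₘ[μ] ℂ) :
    avgNorm μ V E p (g + h : X →ₘ[μ] ℂ) ≤ avgNorm μ V E p g + avgNorm μ V E p h := by
  rw [avgNorm_congr_ae (AEEqFun.coeFn_add g h)]
  exact eLpNorm_add_le (aestronglyMeasurable_avg g _ _) (aestronglyMeasurable_avg h _ _) hp

theorem avgNorm_const_smul {V E : Set X} {p : ℝ≥0∞} (a : ℂ) (g : X →ₘ[μ] ℂ) :
    avgNorm μ V E p (a • g : X →ₘ[μ] ℂ) = ‖a‖ₑ * avgNorm μ V E p g := by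
  rw [avgNorm_congr_ae (AEEqFun.coeFn_smul a g)]
  exact eLpNorm_const_smul a _ _ _

theorem avgNorm_zero {V E : Set X} {p : ℝ≥0∞} : avgNorm μ V E p (0 : X →ₘ[μ] ℂ) = 0 := by
  rw [avgNorm_congr_ae (AEEqFun.coeFn_zero (μ := μ) (β := ℂ) (α := X))]
  exact eLpNorm_zero

theorem rpow_one_div_toReal_le {K : ℝ≥0∞} (hK : 1 ≤ K) {p : ℝ≥0∞} (hp : 1 ≤ p) :
    K ^ (1 / p).toReal ≤ K := by
  have h1 : (1 / p).toReal ≤ 1 := by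
    have : 1 / p ≤ 1 := by simpa using hp
    simpa using ENNReal.toReal_mono ENNReal.one_ne_top this
  simpa using ENNReal.rpow_le_rpow_of_exponent_le hK h1

theorem eLpNorm_le_mul_of_measure_le {ν ν' : Measure X} {K p : ℝ≥0∞} (hK : 1 ≤ K)
    (hp : 1 ≤ p) (h : ν ≤ K • ν') (g : X → ℂ) : eLpNorm g p ν ≤ K * eLpNorm g p ν' := by
  refine (eLpNorm_mono_measure g h).trans ((eLpNorm_smul_measure_le K g p ν').trans ?_)
  rw [smul_eq_mul]
  gcongr
  exact rpow_one_div_toReal_le hK hp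

/-- Enlarging the domain of integration and comparing the normalising volumes. Since `1 ≤ p`, the
`p`-th root of the ratio of the volumes is at most the ratio itself. -/
theorem avgNorm_le_mul {V V' E E' : Set X} {K p : ℝ≥0∞} (hK : 1 ≤ K) (hp : 1 ≤ p)
    (hE : E ⊆ E') (hV' : μ V' ≠ ∞) (h : μ V' ≤ K * μ V) (g : X → ℂ) :
    avgNorm μ V E p g ≤ K * avgNorm μ V' E' p g := by
  refine eLpNorm_le_mul_of_measure_le hK hp ?_ g
  have h1 : (μ V)⁻¹ ≤ K * (μ V')⁻¹ := by
    rcases eq_or_ne K ∞ with rfl | hKt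
    · rw [ENNReal.top_mul (ENNReal.inv_ne_zero.2 hV')]; exact le_top
    rcases eq_or_ne (μ V') 0 with h0 | h0
    · rw [h0, ENNReal.inv_zero, ENNReal.mul_top (by positivity)]; exact le_top
    rw [← div_eq_mul_inv, ENNReal.le_div_iff_mul_le (Or.inl h0) (Or.inl hV'), mul_comm,
      ← div_eq_mul_inv]
    exact ENNReal.div_le_of_le_mul h
  rw [smul_smul]
  refine Measure.le_iff.2 fun A _ => ?_
  simp only [Measure.smul_apply, smul_eq_mul]
  exact mul_le_mul' h1 (Measure.restrict_mono hE le_rfl A)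

theorem avgNorm_mono {V V' E E' : Set X} {p : ℝ≥0∞} (hV : V' ⊆ V) (hE : E ⊆ E') (g : X → ℂ) :
    avgNorm μ V E p g ≤ avgNorm μ V' E' p g :=
  eLpNorm_mono_measure g (by
    refine Measure.le_iff.2 fun A _ => ?_
    simp only [Measure.smul_apply, smul_eq_mul]
    exact mul_le_mul' (ENNReal.inv_le_inv.2 (measure_mono hV)) (Measure.restrict_mono hE le_rfl A))

theorem eLpNorm_restrict_le_biUnion {ν : Measure X} {p : ℝ≥0∞} (hp : 1 ≤ p) {g : X → ℂ}
    (hg : AEStronglyMeasurable g ν) {ι : Type*} (s : Finset ι) (G : ι → Set X)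
    (hG : ∀ i, MeasurableSet (G i)) {F : Set X} (hF : F ⊆ ⋃ i ∈ s, G i) :
    eLpNorm g p (ν.restrict F) ≤ ∑ i ∈ s, eLpNorm g p (ν.restrict (G i)) := by
  classical
  refine (eLpNorm_mono_measure g (Measure.restrict_mono hF le_rfl)).trans ?_
  clear hF
  induction s using Finset.induction_on with
  | empty => simp
  | insert a s ha ih =>
    rw [Finset.sum_insert ha, Finset.set_biUnion_insert]
    refine le_trans ?_ (add_le_add le_rfl ih)
    have hU : MeasurableSet (⋃ x ∈ s, G x) := Finset.measurableSet_biUnion s fun i _ => hG i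
    rw [← Set.union_sdiff_self,
      ← eLpNorm_indicator_eq_eLpNorm_restrict ((hG a).union (hU.diff (hG a))),
      Set.indicator_union_of_disjoint disjoint_sdiff_self_right]
    refine (eLpNorm_add_le (hg.indicator (hG a)) (hg.indicator (hU.diff (hG a))) hp).trans ?_
    rw [eLpNorm_indicator_eq_eLpNorm_restrict (hG a),
      eLpNorm_indicator_eq_eLpNorm_restrict (hU.diff (hG a))]
    gcongr
    exact sdiff_subset

theorem avgNorm_le_sum_biUnion {p : ℝ≥0∞} (hp : 1 ≤ p) (g : X →ₘ[μ] ℂ) {ι : Type*}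
    (s : Finset ι) (G : ι → Set X) (hG : ∀ i, MeasurableSet (G i)) {V F : Set X}
    (hF : F ⊆ ⋃ i ∈ s, G i) :
    avgNorm μ V F p g ≤ ∑ i ∈ s, avgNorm μ V (G i) p g := by
  simp only [avgNorm, ← Measure.restrict_smul]
  exact eLpNorm_restrict_le_biUnion hp (g.aestronglyMeasurable.smul_measure _) s G hG hF

end

section

variable {X : Type*} [MetricSpace X] [MeasurableSpace X] {μ : Measure X}
  {𝔹 : Type*} [NormedAddCommGroup 𝔹] [NormedSpace ℂ 𝔹]

/-- Fatou's lemma for averaged norms, along a sequence converging in measure on the ball. -/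
theorem ballAvg_le_of_tendstoInMeasure {x : X} {r : ℝ} {p K : ℝ≥0∞} {u : ℕ → X →ₘ[μ] ℂ}
    {g : X →ₘ[μ] ℂ}
    (hu : TendstoInMeasure (μ.restrict (ball x r)) (fun n => (u n : X → ℂ)) atTop (g : X → ℂ))
    (h : ∀ n, ballAvg μ x r p (u n) ≤ K) : ballAvg μ x r p g ≤ K := by
  obtain ⟨ns, -, hns⟩ := hu.exists_seq_tendsto_ae
  refine (Lp.eLpNorm_lim_le_liminf_eLpNorm
    (fun n => aestronglyMeasurable_avg (u (ns n)) _ _) _ (Measure.ae_smul_measure hns _)).trans ?_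
  exact liminf_le_of_le (by isBoundedDefault) fun b hb => by
    obtain ⟨n, hn⟩ := hb.exists
    exact hn.trans (h _)

theorem ballAvg_mono_exponent {x : X} {r : ℝ} {p q : ℝ≥0∞} (hpq : p ≤ q)
    (h0 : μ (ball x r) ≠ 0) (ht : μ (ball x r) ≠ ∞) (g : X →ₘ[μ] ℂ) :
    ballAvg μ x r p g ≤ ballAvg μ x r q g := by
  have : IsProbabilityMeasure ((μ (ball x r))⁻¹ • μ.restrict (ball x r)) :=
    ⟨by simp [ENNReal.inv_mul_cancel h0 ht]⟩
  exact eLpNorm_le_eLpNorm_of_exponent_le hpq (aestronglyMeasurable_avg g _ _)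

/-! ### Truncations -/

theorem BanachFunctionSpace.ext_ae (S : BanachFunctionSpace μ 𝔹) {f g : 𝔹}
    (h : (S.toFun f : X → ℂ) =ᵐ[μ] (S.toFun g : X → ℂ)) : f = g :=
  S.injective (AEEqFun.ext h)

theorem BanachFunctionSpace.trunc_trunc (S : BanachFunctionSpace μ 𝔹) {E F : Set X}
    (hE : MeasurableSet E) (hF : MeasurableSet F) (f : 𝔹) :
    S.trunc E (S.trunc F f) = S.trunc (E ∩ F) f := by
  apply S.ext_ae
  filter_upwards [S.trunc_ae_eq hE (S.trunc F f), S.trunc_ae_eq hF f,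
    S.trunc_ae_eq (hE.inter hF) f] with x h1 h2 h3
  rw [h1, h3, ← Set.indicator_indicator]
  by_cases hx : x ∈ E <;> simp [hx, h2]

theorem BanachFunctionSpace.trunc_union (S : BanachFunctionSpace μ 𝔹) {E F : Set X}
    (hE : MeasurableSet E) (hF : MeasurableSet F) (hd : Disjoint E F) (f : 𝔹) :
    S.trunc (E ∪ F) f = S.trunc E f + S.trunc F f := by
  apply S.ext_ae
  rw [map_add]
  filter_upwards [S.trunc_ae_eq hE f, S.trunc_ae_eq hF f, S.trunc_ae_eq (hE.union hF) f,
    AEEqFun.coeFn_add (S.toFun (S.trunc E f)) (S.toFun (S.trunc F f))] with x h1 h2 h3 h4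
  rw [h3, h4, Pi.add_apply, h1, h2, Set.indicator_union_of_disjoint hd]

theorem BanachFunctionSpace.trunc_empty (S : BanachFunctionSpace μ 𝔹) (f : 𝔹) :
    S.trunc ∅ f = 0 := by
  apply S.ext_ae
  rw [map_zero]
  filter_upwards [S.trunc_ae_eq MeasurableSet.empty f,
    AEEqFun.coeFn_zero (μ := μ) (β := ℂ) (α := X)] with x h1 h2
  rw [h1, h2]
  simp

/-- Truncating a function amounts to shrinking the domain of integration. -/
theorem avgNorm_trunc (S : BanachFunctionSpace μ 𝔹) {V E Q : Set X} (hQ : MeasurableSet Q)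
    (p : ℝ≥0∞) (f : 𝔹) :
    avgNorm μ V E p (S.toFun (S.trunc Q f)) = avgNorm μ V (E ∩ Q) p (S.toFun f) := by
  rw [avgNorm_congr_ae (S.trunc_ae_eq hQ f), avgNorm, avgNorm,
    eLpNorm_indicator_eq_eLpNorm_restrict hQ, Measure.restrict_smul,
    Measure.restrict_restrict hQ, inter_comm]

/-- If every measurable piece of `E` inside a member `G i` of a finite cover of `E` is mapped by
`A` to a function of averaged norm at most `Φ i`, then `A (χ_E f)` has averaged norm at most
`∑ Φ i`: the cover is made disjoint and the pieces are added up. -/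
theorem avgNorm_map_trunc_le_sum (S : BanachFunctionSpace μ 𝔹) (A : 𝔹 →L[ℂ] 𝔹) (f : 𝔹)
    {p : ℝ≥0∞} (hp : 1 ≤ p) {V F : Set X} {ι : Type*} (s : Finset ι) (G : ι → Set X)
    (hG : ∀ i, MeasurableSet (G i)) (Φ : ι → ℝ≥0∞) {E : Set X} (hE : MeasurableSet E)
    (hcov : E ⊆ ⋃ i ∈ s, G i)
    (h : ∀ i ∈ s, ∀ Q ⊆ E ∩ G i, MeasurableSet Q → Q.Nonempty →
      avgNorm μ V F p (S.toFun (A (S.trunc Q f))) ≤ Φ i) :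
    avgNorm μ V F p (S.toFun (A (S.trunc E f))) ≤ ∑ i ∈ s, Φ i := by
  classical
  induction s using Finset.induction_on generalizing E with
  | empty =>
    have : E = ∅ := by simpa using hcov
    rw [this, S.trunc_empty, map_zero, map_zero, avgNorm_zero]
    exact zero_le
  | insert a s ha ih =>
    rw [Finset.sum_insert ha, ← inter_union_sdiff E (G a),
      S.trunc_union (hE.inter (hG a)) (hE.diff (hG a))
        (disjoint_sdiff_self_right.mono_left inter_subset_right), map_add, map_add]
    refine (avgNorm_add_le hp _ _).trans (add_le_add ?_ ?_)
    · rcases (E ∩ G a).eq_empty_or_nonempty with h0 | h0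
      · rw [h0, S.trunc_empty, map_zero, map_zero, avgNorm_zero]
        exact zero_le
      · exact h a (Finset.mem_insert_self _ _) _ subset_rfl (hE.inter (hG a)) h0
    · refine ih (hE.diff (hG a)) ?_ fun i hi Q hQ hQm hQn =>
        h i (Finset.mem_insert_of_mem hi) Q (hQ.trans ?_) hQm hQn
      · intro x hx
        have := hcov hx.1
        rw [Finset.set_biUnion_insert] at this
        exact this.resolve_left hx.2
      · exact inter_subset_inter_left _ sdiff_subset

end

section

variable {X : Type*} [MetricSpace X] [MeasurableSpace X] {μ : Measure X}

/-! ### Volume doubling and coverings -/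

/-- Quantitative volume doubling with constant `2 ^ b`, for a measure that charges every ball.
Writing the constant as a power of two turns volume ratios at dyadic radii into integer powers
of the ratio of the radii. -/
structure DoublingWith (μ : Measure X) (b : ℕ) : Prop where
  le : ∀ (x : X) (r : ℝ), 0 < r → μ (ball x (2 * r)) ≤ 2 ^ b * μ (ball x r)
  ne_top : ∀ (x : X) (r : ℝ), μ (ball x r) ≠ ∞
  ne_zero : ∀ (x : X) (r : ℝ), 0 < r → μ (ball x r) ≠ 0

theorem exists_two_pow_mul_gt {R r : ℝ} (hr : 0 < r) : ∃ k : ℕ, R < 2 ^ k * r := by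
  obtain ⟨k, hk⟩ := pow_unbounded_of_one_lt (R / r) (one_lt_two)
  exact ⟨k, (div_lt_iff₀ hr).1 hk⟩

/-- A measure of homogeneous type either vanishes or charges every ball. -/
theorem IsHomogeneousType.eq_zero_or_doublingWith (hμ : IsHomogeneousType μ) :
    μ = 0 ∨ ∃ b, DoublingWith μ b := by
  obtain ⟨C₀, h⟩ := hμ
  by_cases h0 : ∃ (x : X) (r : ℝ), 0 < r ∧ μ (ball x r) = 0
  · obtain ⟨x, r, hr, hx⟩ := h0
    left
    have hk : ∀ k : ℕ, μ (ball x (2 ^ k * r)) = 0 := by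
      intro k
      induction k with
      | zero => simpa using hx
      | succ k ih =>
        have := (h x (2 ^ k * r) (by positivity)).1
        rw [ih, mul_zero] at this
        rw [pow_succ', mul_assoc]
        exact le_antisymm this zero_le
    rw [← Measure.measure_univ_eq_zero]
    refine measure_mono_null (fun y _ => ?_) (measure_iUnion_null hk)
    obtain ⟨k, hk⟩ := exists_two_pow_mul_gt (R := dist y x) hr
    exact mem_iUnion.2 ⟨k, hk⟩
  · push Not at h0
    right
    obtain ⟨b, hb⟩ := pow_unbounded_of_one_lt C₀ (one_lt_two)
    refine ⟨b, fun x r hr => (h x r hr).1.trans ?_, fun x r => ?_, h0⟩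
    · gcongr
      exact_mod_cast hb.le
    · rcases lt_or_ge 0 r with hr | hr
      · exact (h x r hr).2.ne
      · simp [ball_eq_empty.2 hr]

namespace DoublingWith

variable {b : ℕ}

theorem pow_le (h : DoublingWith μ b) (x : X) {r : ℝ} (hr : 0 < r) (k : ℕ) :
    μ (ball x (2 ^ k * r)) ≤ 2 ^ (b * k) * μ (ball x r) := by
  induction k with
  | zero => simp
  | succ k ih =>
    calc μ (ball x (2 ^ (k + 1) * r)) = μ (ball x (2 * (2 ^ k * r))) := by ring_nf
      _ ≤ 2 ^ b * μ (ball x (2 ^ k * r)) := h.le x _ (by positivity)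
      _ ≤ 2 ^ b * (2 ^ (b * k) * μ (ball x r)) := by gcongr
      _ = 2 ^ (b * (k + 1)) * μ (ball x r) := by ring

theorem le_pow_mul (h : DoublingWith μ b) {x y : X} {R r : ℝ} (hr : 0 < r) (k : ℕ)
    (hR : R + dist x y ≤ 2 ^ k * r) : μ (ball x R) ≤ 2 ^ (b * k) * μ (ball y r) :=
  (measure_mono (ball_subset_ball' hR)).trans (h.pow_le y hr k)

variable [BorelSpace X]

theorem card_le_of_separated (h : DoublingWith μ b) (x : X) {ρ : ℝ} (hρ : 0 < ρ) (t : Finset X)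
    (ht : ∀ z ∈ t, z ∈ ball x (2 * ρ)) (hs : ∀ z ∈ t, ∀ w ∈ t, z ≠ w → ρ ≤ dist z w) :
    t.card ≤ 2 ^ (4 * b) := by
  -- The balls of radius `ρ / 2` about the points of `t` are disjoint, lie in `ball x (4 * ρ)`,
  -- and each carries at least the fraction `2 ^ (-4 b)` of its measure.
  have h1 : ∑ z ∈ t, μ (ball z (ρ / 2)) ≤ μ (ball x (4 * ρ)) := by
    rw [← measure_biUnion_finset _ fun z _ => measurableSet_ball]
    · refine measure_mono (iUnion₂_subset fun z hz => ball_subset_ball' ?_)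
      have := mem_ball.1 (ht z hz)
      linarith
    · intro z hz w hw hzw
      refine ball_disjoint_ball ?_
      linarith [hs z hz w hw hzw]
  have h2 : ∀ z ∈ t, μ (ball x (4 * ρ)) ≤ 2 ^ (4 * b) * μ (ball z (ρ / 2)) := by
    intro z hz
    have := mem_ball'.1 (ht z hz)
    rw [mul_comm 4 b]
    exact h.le_pow_mul (by positivity) 4 (by linarith)
  have h3 : (t.card : ℝ≥0∞) * μ (ball x (4 * ρ)) ≤ 2 ^ (4 * b) * μ (ball x (4 * ρ)) := by
    calc (t.card : ℝ≥0∞) * μ (ball x (4 * ρ)) = ∑ z ∈ t, μ (ball x (4 * ρ)) := by simp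
      _ ≤ ∑ z ∈ t, 2 ^ (4 * b) * μ (ball z (ρ / 2)) := Finset.sum_le_sum h2
      _ ≤ _ := by rw [← Finset.mul_sum]; gcongr
  have h4 := (ENNReal.mul_le_mul_iff_left (h.ne_zero x (4 * ρ) (by positivity))
    (h.ne_top x (4 * ρ))).1 h3
  exact_mod_cast h4

theorem exists_cover_two_mul (h : DoublingWith μ b) (x : X) {ρ : ℝ} (hρ : 0 < ρ) :
    ∃ t : Finset X, t.card ≤ 2 ^ (4 * b) ∧ ball x (2 * ρ) ⊆ ⋃ z ∈ t, ball z ρ := by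
  classical
  by_contra! hcon
  have key : ∀ n : ℕ, ∃ t : Finset X, t.card = n ∧ (∀ z ∈ t, z ∈ ball x (2 * ρ)) ∧
      (∀ z ∈ t, ∀ w ∈ t, z ≠ w → ρ ≤ dist z w) := by
    intro n
    induction n with
    | zero => exact ⟨∅, by simp⟩
    | succ n ih =>
      obtain ⟨t, htn, htb, hts⟩ := ih
      obtain ⟨w, hw, hwt⟩ := not_subset.1 (hcon t (h.card_le_of_separated x hρ t htb hts))
      simp only [mem_iUnion, mem_ball, not_exists, not_lt] at hwt
      have hwn : w ∉ t := fun hh => by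
        have := hwt w hh
        rw [dist_self] at this
        linarith
      refine ⟨insert w t, by rw [Finset.card_insert_of_notMem hwn, htn], ?_, ?_⟩
      · intro z hz
        rcases Finset.mem_insert.1 hz with rfl | hz
        exacts [hw, htb z hz]
      · intro z hz v hv hzv
        rcases Finset.mem_insert.1 hz with hz' | hz' <;>
          rcases Finset.mem_insert.1 hv with hv' | hv'
        · exact absurd (hz'.trans hv'.symm) hzv
        · rw [hz']; exact hwt v hv'
        · rw [hv', dist_comm]; exact hwt z hz'
        · exact hts z hz' v hv' hzv
  obtain ⟨t, htn, htb, hts⟩ := key (2 ^ (4 * b) + 1)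
  have := h.card_le_of_separated x hρ t htb hts
  omega

theorem exists_cover_ball (h : DoublingWith μ b) (x : X) {ρ : ℝ} (hρ : 0 < ρ) (k : ℕ) :
    ∃ t : Finset X, t.card ≤ 2 ^ (4 * b * k) ∧ ball x (2 ^ k * ρ) ⊆ ⋃ z ∈ t, ball z ρ := by
  classical
  induction k generalizing ρ with
  | zero => exact ⟨{x}, by simp⟩
  | succ k ih =>
    obtain ⟨t, htc, ht⟩ := ih (ρ := 2 * ρ) (by positivity)
    choose u huc hu using fun z => h.exists_cover_two_mul z hρ
    refine ⟨t.biUnion u, ?_, ?_⟩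
    · refine Finset.card_biUnion_le.trans ((Finset.sum_le_sum fun z _ => huc z).trans ?_)
      rw [Finset.sum_const, smul_eq_mul, mul_add, pow_add, mul_one]
      gcongr
    · rw [pow_succ, mul_assoc]
      intro y hy
      obtain ⟨z, hz, hyz⟩ := mem_iUnion₂.1 (ht hy)
      obtain ⟨w, hw, hyw⟩ := mem_iUnion₂.1 (hu z hyz)
      exact mem_iUnion₂.2 ⟨w, Finset.mem_biUnion.2 ⟨z, hz, hw⟩, hyw⟩

/-- A subset of a ball of radius `2 ^ k * ρ` is covered by at most `2 ^ (4 * b * k)` balls of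
radius `ρ`, each of which meets it. -/
theorem exists_cover (h : DoublingWith μ b) {x : X} {ρ : ℝ} (hρ : 0 < ρ) {k : ℕ} {E : Set X}
    (hE : E ⊆ ball x (2 ^ k * ρ)) :
    ∃ t : Finset X, t.card ≤ 2 ^ (4 * b * k) ∧ E ⊆ ⋃ z ∈ t, ball z ρ ∧
      ∀ z ∈ t, ∃ e ∈ E, dist e z < ρ := by
  classical
  obtain ⟨t, htc, ht⟩ := h.exists_cover_ball x hρ k
  refine ⟨t.filter fun z => ∃ e ∈ E, dist e z < ρ, (Finset.card_filter_le _ _).trans htc, ?_, ?_⟩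
  · intro e he
    obtain ⟨z, hz, hez⟩ := mem_iUnion₂.1 (ht (hE he))
    exact mem_iUnion₂.2 ⟨z, Finset.mem_filter.2 ⟨hz, e, he, hez⟩, hez⟩
  · intro z hz
    exact (Finset.mem_filter.1 hz).2

end DoublingWith

end

/-! ### Gaussian factors -/

theorem exists_pow_mul_exp_neg_sq_le (N : ℕ) {c : ℝ} (hc : 0 < c) :
    ∃ K : ℝ, 0 < K ∧ ∀ u : ℝ, 0 ≤ u → u ^ N * Real.exp (-(c * u ^ 2)) ≤ K := by
  refine ⟨1 + N.factorial / c ^ N, by positivity, fun u hu => ?_⟩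
  have h1 := Real.pow_div_factorial_le_exp (x := c * u ^ 2) (by positivity) N
  have h2 : u ^ N ≤ 1 + (u ^ 2) ^ N := by
    rw [← pow_mul, mul_comm 2 N, pow_mul]
    nlinarith [sq_nonneg (u ^ N - 1)]
  have h3 : (u ^ 2) ^ N ≤ N.factorial / c ^ N * Real.exp (c * u ^ 2) := by
    rw [div_le_iff₀ (by positivity), mul_pow] at h1
    rw [div_mul_eq_mul_div, le_div_iff₀ (by positivity)]
    linarith
  have h4 : Real.exp (-(c * u ^ 2)) * Real.exp (c * u ^ 2) = 1 := by
    rw [← Real.exp_add]; simp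
  have h5 : Real.exp (-(c * u ^ 2)) ≤ 1 := Real.exp_le_one_iff.2 (by
    have : 0 ≤ c * u ^ 2 := by positivity
    linarith)
  calc u ^ N * Real.exp (-(c * u ^ 2))
      ≤ (1 + N.factorial / c ^ N * Real.exp (c * u ^ 2)) * Real.exp (-(c * u ^ 2)) := by
        gcongr; linarith
    _ = Real.exp (-(c * u ^ 2)) + N.factorial / c ^ N := by
        linear_combination (N.factorial / c ^ N : ℝ) * h4
    _ ≤ _ := by linarith

theorem exists_pow_mul_exp_neg_sq_le_exp (N : ℕ) {c : ℝ} (hc : 0 < c) :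
    ∃ K : ℝ, 0 < K ∧ ∀ u : ℝ, 0 ≤ u →
      u ^ N * Real.exp (-(c * u ^ 2)) ≤ K * Real.exp (-(c / 2 * u ^ 2)) := by
  obtain ⟨K, hK, h⟩ := exists_pow_mul_exp_neg_sq_le N (half_pos hc)
  refine ⟨K, hK, fun u hu => ?_⟩
  have : Real.exp (-(c * u ^ 2)) = Real.exp (-(c / 2 * u ^ 2)) * Real.exp (-(c / 2 * u ^ 2)) := by
    rw [← Real.exp_add]; ring_nf
  rw [this, ← mul_assoc]
  gcongr
  exact h u hu

/-- Gaussian decay beats the number of balls of unit radius needed to cover dyadic shells. -/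
theorem exists_sum_dyadic_exp_le (a : ℕ) {c : ℝ} (hc : 0 < c) :
    ∃ K : ℝ, 0 < K ∧ ∀ n : ℕ, ∑ k ∈ Finset.range n,
      ((2 : ℝ) ^ k) ^ a * Real.exp (-(c * (2 ^ k) ^ 2)) ≤ K := by
  obtain ⟨K, hK, h⟩ := exists_pow_mul_exp_neg_sq_le (a + 1) hc
  refine ⟨K * 2, by positivity, fun n => ?_⟩
  have hterm : ∀ k : ℕ, ((2 : ℝ) ^ k) ^ a * Real.exp (-(c * (2 ^ k) ^ 2)) ≤ K * (1 / 2) ^ k := by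
    intro k
    have hu : (0 : ℝ) < 2 ^ k := by positivity
    rw [one_div, inv_pow, ← div_eq_mul_inv, le_div_iff₀ hu]
    refine le_trans (le_of_eq ?_) (h (2 ^ k) hu.le)
    ring
  refine (Finset.sum_le_sum fun k _ => hterm k).trans ?_
  rw [← Finset.mul_sum]
  gcongr
  have := (summable_geometric_two).sum_le_tsum (Finset.range n) fun _ _ => by positivity
  rwa [tsum_geometric_two] at this

section

variable {X : Type*} [MetricSpace X] [MeasurableSpace X] {μ : Measure X}
  {𝔹 : Type*} [NormedAddCommGroup 𝔹] [NormedSpace ℂ 𝔹]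

/-! ### Gaussian bounds at a fixed scale -/

/-- Gaussian off-diagonal bounds for a single operator `A` at the length scale `ρ`: from `L^p` of
any ball of radius `ρ` to `L^q` of any other, with averaged norms on both sides and decay in the
distance of the centres measured in units of `ρ`. No integrability of `f` is required: if the
right-hand average is infinite the inequality is void. -/
def GaussBound (S : BanachFunctionSpace μ 𝔹) (p q : ℝ≥0∞) (ρ C c : ℝ) (A : 𝔹 →L[ℂ] 𝔹) : Prop :=
  ∀ (x y : X) (f : 𝔹), ballAvg μ x ρ q (S.toFun (A (S.trunc (ball y ρ) f))) ≤
    ENNReal.ofReal (C * Real.exp (-(c * (dist x y / ρ) ^ 2))) * ballAvg μ y ρ p (S.toFun f)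

namespace GaussBound

variable {S : BanachFunctionSpace μ 𝔹} {p q : ℝ≥0∞} {ρ C c : ℝ} {A : 𝔹 →L[ℂ] 𝔹} {b : ℕ}

theorem mono (h : GaussBound S p q ρ C c A) {C' c' : ℝ} (hC : C ≤ C') (hC' : 0 ≤ C')
    (hc : c' ≤ c) : GaussBound S p q ρ C' c' A := by
  intro x y f
  refine (h x y f).trans ?_
  gcongr

theorem mono_right (h : GaussBound S p q ρ C c A) (hD : DoublingWith μ b) (hρ : 0 < ρ)
    {q' : ℝ≥0∞} (hq : q' ≤ q) : GaussBound S p q' ρ C c A := fun x y f =>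
  (ballAvg_mono_exponent hq (hD.ne_zero x ρ hρ) (hD.ne_top x ρ) _).trans (h x y f)

theorem mono_left (h : GaussBound S p q ρ C c A) (hD : DoublingWith μ b) (hρ : 0 < ρ)
    {p' : ℝ≥0∞} (hp : p ≤ p') : GaussBound S p' q ρ C c A := fun x y f =>
  (h x y f).trans (by
    gcongr
    exact ballAvg_mono_exponent hp (hD.ne_zero y ρ hρ) (hD.ne_top y ρ) _)

variable [BorelSpace X]

theorem ballAvg_trunc_le (h : GaussBound S p q ρ C c A) {x y : X} {Q : Set X}
    (hQ : MeasurableSet Q) (hQy : Q ⊆ ball y ρ) (f : 𝔹) :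
    ballAvg μ x ρ q (S.toFun (A (S.trunc Q f))) ≤
      ENNReal.ofReal (C * Real.exp (-(c * (dist x y / ρ) ^ 2))) *
        avgNorm μ (ball y ρ) Q p (S.toFun f) := by
  have h1 := h x y (S.trunc Q f)
  rwa [S.trunc_trunc measurableSet_ball hQ, inter_eq_right.2 hQy, ballAvg, ballAvg,
    avgNorm_trunc S hQ, inter_eq_right.2 hQy] at h1

/-- The bound at scale `ρ` transferred to subsets `E`, `F` of a larger ball of radius
`R ≈ 2 ^ k ρ`, at the cost of a power of `R / ρ`: cover both sets by balls of radius `ρ`. -/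
theorem avgNorm_le_of_scale_le (h : GaussBound S p q ρ C c A) (hD : DoublingWith μ b)
    (hp : 1 ≤ p) (hq : 1 ≤ q) (hC : 0 ≤ C) (hc : 0 ≤ c) (hρ : 0 < ρ) {R : ℝ} {k : ℕ}
    (hR : ρ ≤ R) (hk : R ≤ 2 ^ k * ρ) {x : X} {E F : Set X} (hE : MeasurableSet E)
    (hEx : E ⊆ ball x R) (hFx : F ⊆ ball x R) {δ : ℝ} (hδ : 0 ≤ δ)
    (hEF : ∀ e ∈ E, ∀ y ∈ F, δ ≤ dist y e) (f : 𝔹) :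
    avgNorm μ (ball x R) F q (S.toFun (A (S.trunc E f))) ≤
      2 ^ (9 * b * k + 4 * b) *
        ENNReal.ofReal (C * (Real.exp (4 * c) * Real.exp (-(c / 2 * (δ / ρ) ^ 2)))) *
          avgNorm μ (ball x R) E p (S.toFun f) := by
  have hR0 : 0 < R := hρ.trans_le hR
  obtain ⟨s, hsc, hsE, hs⟩ := hD.exists_cover hρ (hEx.trans (ball_subset_ball hk))
  obtain ⟨t, htc, htF, ht⟩ := hD.exists_cover hρ (hFx.trans (ball_subset_ball hk))
  set κ := ENNReal.ofReal (C * (Real.exp (4 * c) * Real.exp (-(c / 2 * (δ / ρ) ^ 2))))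
  set N := avgNorm μ (ball x R) E p (S.toFun f)
  have hone : ∀ n : ℕ, (1 : ℝ≥0∞) ≤ 2 ^ n := fun n => one_le_pow₀ one_le_two
  have hpiece : ∀ w ∈ t, ∀ z ∈ s, ∀ Q ⊆ E ∩ ball z ρ, MeasurableSet Q → Q.Nonempty →
      avgNorm μ (ball w ρ) (ball w ρ) q (S.toFun (A (S.trunc Q f))) ≤
        κ * (2 ^ (b * (k + 2)) * N) := by
    intro w hw z hz Q hQ hQm _
    refine (h.ballAvg_trunc_le hQm (hQ.trans inter_subset_right) f).trans ?_
    obtain ⟨e, heE, hez⟩ := hs z hz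
    obtain ⟨y, hyF, hyw⟩ := ht w hw
    have hxe := mem_ball.1 (hEx heE)
    gcongr ?_ * ?_
    · refine ENNReal.ofReal_le_ofReal ?_
      gcongr
      rw [← Real.exp_add, Real.exp_le_exp]
      have h1 : δ ≤ dist w z + 2 * ρ := by
        have h2 := hEF e heE y hyF
        have h3 := dist_triangle4 y w z e
        rw [dist_comm z e] at h3
        linarith
      have h2 : δ / ρ ≤ dist w z / ρ + 2 := by
        rw [div_add' _ _ _ hρ.ne', div_le_div_iff_of_pos_right hρ]
        exact h1
      have h3 : 0 ≤ δ / ρ := by positivity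
      have h4 : (δ / ρ) ^ 2 ≤ 2 * (dist w z / ρ) ^ 2 + 8 := by
        nlinarith [sq_nonneg (dist w z / ρ - 2)]
      nlinarith
    · refine avgNorm_le_mul (hone _) hp (hQ.trans inter_subset_left) (hD.ne_top _ _) ?_ _
      refine hD.le_pow_mul hρ (k + 2) ?_
      have h1 : dist x z ≤ R + ρ := by
        have := dist_triangle x e z
        rw [dist_comm x e] at this
        linarith
      rw [pow_add]
      linarith
  have hball : ∀ w ∈ t, avgNorm μ (ball x R) (ball w ρ) q (S.toFun (A (S.trunc E f))) ≤
      2 ^ (b * 2) * (2 ^ (4 * b * k) * (κ * (2 ^ (b * (k + 2)) * N))) := by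
    intro w hw
    obtain ⟨y, hyF, hyw⟩ := ht w hw
    have hxy := mem_ball.1 (hFx hyF)
    refine (avgNorm_le_mul (hone (b * 2)) hq subset_rfl (hD.ne_top w ρ) ?_ _).trans ?_
    · refine hD.le_pow_mul hR0 2 ?_
      have := dist_triangle w y x
      rw [dist_comm w y] at this
      linarith
    · gcongr
      refine (avgNorm_map_trunc_le_sum S A f hq s (fun z => ball z ρ)
        (fun z => measurableSet_ball) (fun _ => κ * (2 ^ (b * (k + 2)) * N)) hE hsE
        (hpiece w hw)).trans ?_
      rw [Finset.sum_const, nsmul_eq_mul]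
      gcongr
      exact_mod_cast hsc
  refine (avgNorm_le_sum_biUnion hq _ t (fun w => ball w ρ) (fun w => measurableSet_ball)
    htF).trans ((Finset.sum_le_sum hball).trans ?_)
  rw [Finset.sum_const, nsmul_eq_mul]
  calc (t.card : ℝ≥0∞) * (2 ^ (b * 2) * (2 ^ (4 * b * k) * (κ * (2 ^ (b * (k + 2)) * N))))
      ≤ 2 ^ (4 * b * k) * (2 ^ (b * 2) * (2 ^ (4 * b * k) * (κ * (2 ^ (b * (k + 2)) * N)))) := by
        gcongr
        exact_mod_cast htc
    _ = _ := by ring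

/-- The bound at scale `ρ` transferred to subsets of a ball of arbitrary radius `R`. -/
theorem avgNorm_le (h : GaussBound S p q ρ C c A) (hD : DoublingWith μ b)
    (hp : 1 ≤ p) (hq : 1 ≤ q) (hC : 0 ≤ C) (hc : 0 ≤ c) (hρ : 0 < ρ) {R : ℝ} (hR : 0 < R)
    {x : X} {E F : Set X} (hE : MeasurableSet E)
    (hEx : E ⊆ ball x R) (hFx : F ⊆ ball x R) {δ : ℝ} (hδ : 0 ≤ δ)
    (hEF : ∀ e ∈ E, ∀ y ∈ F, δ ≤ dist y e) (f : 𝔹) :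
    avgNorm μ (ball x R) F q (S.toFun (A (S.trunc E f))) ≤
      ENNReal.ofReal ((2 ^ (13 * b) * upsilon (R / ρ) ^ (9 * b)) *
        (C * (Real.exp (4 * c) * Real.exp (-(c / 2 * (δ / ρ) ^ 2))))) *
          avgNorm μ (ball x R) E p (S.toFun f) := by
  have hU1 : R / ρ ≤ upsilon (R / ρ) := le_max_left _ _
  have hU2 : ρ / R ≤ upsilon (R / ρ) := by rw [← inv_div R ρ]; exact le_max_right _ _
  have hU0 : 0 < upsilon (R / ρ) := lt_of_lt_of_le (by positivity) hU1
  rcases le_or_gt ρ R with hρR | hρR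
  · obtain ⟨n, hn1, hn2⟩ := exists_nat_pow_near ((one_le_div hρ).2 hρR) one_lt_two
    have hk : R ≤ 2 ^ (n + 1) * ρ := ((div_lt_iff₀ hρ).1 hn2).le
    refine (h.avgNorm_le_of_scale_le hD hp hq hC hc hρ hρR hk hE hEx hFx hδ hEF f).trans ?_
    rw [two_pow_mul_ofReal]
    gcongr
    calc (2 : ℝ) ^ (9 * b * (n + 1) + 4 * b) = 2 ^ (13 * b) * (2 ^ n) ^ (9 * b) := by
          rw [← pow_mul, ← pow_add]; ring_nf
      _ ≤ _ := by gcongr; exact hn1.trans hU1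
  · rcases E.eq_empty_or_nonempty with rfl | ⟨e, he⟩
    · rw [S.trunc_empty, map_zero, map_zero, avgNorm_zero]
      exact zero_le
    rcases F.eq_empty_or_nonempty with rfl | ⟨y, hy⟩
    · simp [avgNorm]
    have hδR : δ ≤ 2 * ρ := by
      have h1 := hEF e he y hy
      have h2 := dist_triangle y x e
      have h3 := mem_ball.1 (hFx hy)
      have h4 := mem_ball'.1 (hEx he)
      linarith
    obtain ⟨n, hn1, hn2⟩ := exists_nat_pow_near ((one_le_div hR).2 hρR.le) one_lt_two
    have hk : ρ ≤ 2 ^ (n + 1) * R := ((div_lt_iff₀ hR).1 hn2).le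
    have h1 : avgNorm μ (ball x R) F q (S.toFun (A (S.trunc E f))) ≤
        2 ^ (b * (n + 1)) * ballAvg μ x ρ q (S.toFun (A (S.trunc E f))) :=
      avgNorm_le_mul (one_le_pow₀ one_le_two) hq (hFx.trans (ball_subset_ball hρR.le))
        (hD.ne_top _ _) (hD.le_pow_mul hR (n + 1) (by simpa using hk)) _
    have h2 := h.ballAvg_trunc_le (x := x) hE (hEx.trans (ball_subset_ball hρR.le)) f
    have h3 : avgNorm μ (ball x ρ) E p (S.toFun f) ≤ avgNorm μ (ball x R) E p (S.toFun f) :=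
      avgNorm_mono (ball_subset_ball hρR.le) subset_rfl _
    refine h1.trans ((mul_le_mul' le_rfl (h2.trans (mul_le_mul' le_rfl h3))).trans ?_)
    rw [← mul_assoc, two_pow_mul_ofReal]
    gcongr
    · calc (2 : ℝ) ^ (b * (n + 1)) = 2 ^ b * (2 ^ n) ^ b := by
            rw [← pow_mul, ← pow_add]; ring_nf
        _ ≤ 2 ^ (13 * b) * upsilon (R / ρ) ^ (9 * b) := by
            have hU : 1 ≤ upsilon (R / ρ) := ((one_le_div hR).2 hρR.le).trans hU2
            gcongr ?_ * ?_
            · exact pow_le_pow_right₀ one_le_two (by omega)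
            · exact (pow_le_pow_left₀ (by positivity) (hn1.trans hU2) b).trans
                (pow_le_pow_right₀ hU (by omega))
    · rw [← Real.exp_add, Real.exp_le_exp, dist_self, zero_div]
      have h5 : δ / ρ ≤ 2 := (div_le_iff₀ hρ).2 hδR
      have h6 : 0 ≤ δ / ρ := by positivity
      nlinarith [mul_le_mul h5 h5 h6 zero_le_two]

end GaussBound

end

section

variable {X : Type*} [MetricSpace X]

/-! ### Dyadic shells and composition -/

/-- The dyadic shells about `x` at scale `ρ`: the ball of radius `ρ`, then the annuli between the
radii `2 ^ k ρ` and `2 ^ (k + 1) ρ`. -/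
def dyadicShell (x : X) (ρ : ℝ) : ℕ → Set X
  | 0 => ball x ρ
  | k + 1 => ball x (2 ^ (k + 1) * ρ) \ ball x (2 ^ k * ρ)

theorem dyadicShell_subset_ball (x : X) (ρ : ℝ) (k : ℕ) :
    dyadicShell x ρ k ⊆ ball x (2 ^ k * ρ) := by
  cases k with
  | zero => simp [dyadicShell]
  | succ k => exact sdiff_subset

theorem measurableSet_dyadicShell [MeasurableSpace X] [BorelSpace X] (x : X) (ρ : ℝ) (k : ℕ) :
    MeasurableSet (dyadicShell x ρ k) := by
  cases k with
  | zero => exact measurableSet_ball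
  | succ k => exact measurableSet_ball.diff measurableSet_ball

theorem ball_subset_biUnion_dyadicShell (x : X) (ρ : ℝ) (n : ℕ) :
    ball x (2 ^ n * ρ) ⊆ ⋃ k ∈ Finset.range (n + 1), dyadicShell x ρ k := by
  induction n with
  | zero => simp [dyadicShell]
  | succ n ih =>
    intro y hy
    rw [Finset.range_add_one, Finset.set_biUnion_insert]
    by_cases hn : y ∈ ball x (2 ^ n * ρ)
    · exact Or.inr (ih hn)
    · exact Or.inl ⟨hy, hn⟩

theorem two_pow_le_of_mem_dyadicShell {x e : X} {ρ : ℝ} (hρ : 0 < ρ) {k : ℕ}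
    (he : e ∈ dyadicShell x ρ k) : (2 : ℝ) ^ k * ρ ≤ 2 * dist e x + ρ := by
  cases k with
  | zero =>
    have := dist_nonneg (x := e) (y := x)
    rw [pow_zero]
    linarith
  | succ k =>
    have : ¬ dist e x < 2 ^ k * ρ := he.2
    rw [pow_succ]
    linarith

theorem two_pow_le_of_near_dyadicShell {x z : X} {ρ : ℝ} (hρ : 0 < ρ) {k : ℕ}
    (h : ∃ e ∈ dyadicShell x ρ k, dist e z < ρ) : (2 : ℝ) ^ k ≤ 2 * (dist x z / ρ) + 4 := by
  obtain ⟨e, he, hez⟩ := h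
  have h1 := two_pow_le_of_mem_dyadicShell hρ he
  have h2 := dist_triangle_right e x z
  rw [← mul_div_assoc, div_add' _ _ _ hρ.ne', le_div_iff₀ hρ]
  linarith

theorem eLpNorm_restrict_le_mul_ballAvg [MeasurableSpace X] {μ : Measure X} {b : ℕ}
    (hD : DoublingWith μ b) {x : X} {ρ : ℝ} (hρ : 0 < ρ) {p : ℝ≥0∞} (hp : 1 ≤ p) (g : X → ℂ) :
    eLpNorm g p (μ.restrict (ball x ρ)) ≤ (1 + μ (ball x ρ)) * ballAvg μ x ρ p g := by
  refine eLpNorm_le_mul_of_measure_le le_self_add hp ?_ g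
  rw [smul_smul]
  refine Measure.le_iff.2 fun A _ => ?_
  rw [Measure.smul_apply, smul_eq_mul]
  refine le_mul_of_one_le_left zero_le ?_
  rw [add_mul, ENNReal.mul_inv_cancel (hD.ne_zero x ρ hρ) (hD.ne_top x ρ)]
  exact le_add_self

end

section

variable {X : Type*} [MetricSpace X] [MeasurableSpace X] [BorelSpace X] {μ : Measure X}
  {𝔹 : Type*} [NormedAddCommGroup 𝔹] [NormedSpace ℂ 𝔹]

theorem memLp_trunc_ball (S : BanachFunctionSpace μ 𝔹) {b : ℕ} (hD : DoublingWith μ b) {x : X}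
    {ρ : ℝ} (hρ : 0 < ρ) {p : ℝ≥0∞} (hp : 1 ≤ p) {f : 𝔹}
    (hf : ballAvg μ x ρ p (S.toFun f) ≠ ∞) :
    MemLp (S.toFun (S.trunc (ball x ρ) f) : X → ℂ) p μ := by
  refine ⟨AEEqFun.aestronglyMeasurable _, ?_⟩
  rw [eLpNorm_congr_ae (S.trunc_ae_eq measurableSet_ball f),
    eLpNorm_indicator_eq_eLpNorm_restrict measurableSet_ball]
  refine (eLpNorm_restrict_le_mul_ballAvg hD hρ hp _).trans_lt ?_
  exact ENNReal.mul_lt_top (ENNReal.add_lt_top.2 ⟨ENNReal.one_lt_top, (hD.ne_top x ρ).lt_top⟩)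
    hf.lt_top

theorem eLpNorm_le_of_forall_restrict_ball {g : X → ℂ} (hg : AEStronglyMeasurable g μ)
    {p K : ℝ≥0∞} (x : X) {ρ : ℝ} (hρ : 0 < ρ)
    (h : ∀ n : ℕ, eLpNorm g p (μ.restrict (ball x (2 ^ n * ρ))) ≤ K) : eLpNorm g p μ ≤ K := by
  refine (Lp.eLpNorm_lim_le_liminf_eLpNorm (f := fun n => (ball x (2 ^ n * ρ)).indicator g)
    (fun n => hg.indicator measurableSet_ball) g (ae_of_all _ fun y => ?_)).trans ?_
  · obtain ⟨k, hk⟩ := exists_two_pow_mul_gt (R := dist y x) hρ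
    refine tendsto_const_nhds.congr' ?_
    filter_upwards [eventually_ge_atTop k] with n hn
    rw [indicator_of_mem]
    refine mem_ball.2 (hk.trans_le ?_)
    gcongr
    exact one_le_two
  · refine liminf_le_of_le (by isBoundedDefault) fun a ha => ?_
    obtain ⟨n, hn⟩ := ha.exists
    rw [eLpNorm_indicator_eq_eLpNorm_restrict measurableSet_ball] at hn
    exact hn.trans (h n)

namespace GaussBound

variable {S : BanachFunctionSpace μ 𝔹} {p q : ℝ≥0∞} {ρ C c : ℝ} {A : 𝔹 →L[ℂ] 𝔹} {b : ℕ}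

/-- An operator with Gaussian bounds maps functions supported in a ball to globally integrable
functions: the decay outweighs the growth of the volume. -/
theorem memLp (h : GaussBound S p q ρ C c A) (hD : DoublingWith μ b) (hq : 1 ≤ q)
    (hC : 0 ≤ C) (hc : 0 < c) (hρ : 0 < ρ) {y : X} {f : 𝔹}
    (hf : ballAvg μ y ρ p (S.toFun f) ≠ ∞) :
    MemLp (S.toFun (A (S.trunc (ball y ρ) f)) : X → ℂ) q μ := by
  set g := S.toFun (A (S.trunc (ball y ρ) f))
  set N := ballAvg μ y ρ p (S.toFun f)
  obtain ⟨K, hK, hsum⟩ := exists_sum_dyadic_exp_le (5 * b) (c := c / 8) (by positivity)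
  set W : ℝ≥0∞ := 2 ^ (2 * b) * (1 + μ (ball y ρ)) * N
  set a : ℕ → ℝ := fun k => (2 ^ k) ^ (5 * b) * Real.exp (-(c / 8 * (2 ^ k) ^ 2))
  have hshell : ∀ k : ℕ, eLpNorm g q (μ.restrict (dyadicShell y ρ k)) ≤
      ENNReal.ofReal (C * Real.exp (4 * c) * a k) * W := by
    intro k
    obtain ⟨t, htc, htE, ht⟩ := hD.exists_cover hρ (dyadicShell_subset_ball y ρ k)
    refine (eLpNorm_restrict_le_biUnion hq g.aestronglyMeasurable t (fun z => ball z ρ)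
      (fun z => measurableSet_ball) htE).trans ?_
    have hz : ∀ z ∈ t, eLpNorm g q (μ.restrict (ball z ρ)) ≤
        (2 ^ (b * (k + 2)) * (1 + μ (ball y ρ))) *
          (ENNReal.ofReal (C * (Real.exp (4 * c) * Real.exp (-(c / 8 * (2 ^ k) ^ 2)))) * N) := by
      intro z hz
      refine (eLpNorm_restrict_le_mul_ballAvg hD hρ hq _).trans ?_
      gcongr
      · rw [mul_add, mul_one]
        gcongr
        · exact one_le_pow₀ one_le_two
        · refine hD.le_pow_mul hρ (k + 2) ?_
          obtain ⟨e, he, hez⟩ := ht z hz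
          have h1 := mem_ball.1 (dyadicShell_subset_ball y ρ k he)
          have h2 := dist_triangle_left z y e
          have h3 : ρ ≤ 2 ^ k * ρ := le_mul_of_one_le_left hρ.le (one_le_pow₀ one_le_two)
          rw [pow_add]
          linarith
      · refine (h z y f).trans ?_
        gcongr
        rw [← Real.exp_add, Real.exp_le_exp]
        have h1 := two_pow_le_of_near_dyadicShell hρ (ht z hz)
        have h2 : (0 : ℝ) ≤ 2 ^ k := by positivity
        have h3 : 0 ≤ dist y z / ρ := by positivity
        have h4 : ((2 : ℝ) ^ k) ^ 2 ≤ 8 * (dist y z / ρ) ^ 2 + 32 := by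
          nlinarith [sq_nonneg (2 * (dist y z / ρ) - 4)]
        rw [dist_comm z y]
        nlinarith
    refine (Finset.sum_le_sum hz).trans ?_
    rw [Finset.sum_const, nsmul_eq_mul]
    calc _ ≤ (2 : ℝ≥0∞) ^ (4 * b * k) * ((2 ^ (b * (k + 2)) * (1 + μ (ball y ρ))) *
          (ENNReal.ofReal (C * (Real.exp (4 * c) * Real.exp (-(c / 8 * (2 ^ k) ^ 2)))) * N)) := by
          gcongr
          exact_mod_cast htc
      _ = ((2 : ℝ≥0∞) ^ (5 * b * k) *
          ENNReal.ofReal (C * (Real.exp (4 * c) * Real.exp (-(c / 8 * (2 ^ k) ^ 2))))) * W := by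
          simp only [W]; ring
      _ = _ := by
          congr 1
          rw [two_pow_mul_ofReal]
          congr 1
          simp only [a]
          rw [← pow_mul 2 k, mul_comm k]
          ring
  refine ⟨g.aestronglyMeasurable, lt_of_le_of_lt (eLpNorm_le_of_forall_restrict_ball
    (K := ENNReal.ofReal (C * Real.exp (4 * c) * K) * W) g.aestronglyMeasurable y hρ
      fun n => ?_) ?_⟩
  · refine (eLpNorm_restrict_le_biUnion hq g.aestronglyMeasurable _ (dyadicShell y ρ)
      (measurableSet_dyadicShell y ρ) (ball_subset_biUnion_dyadicShell y ρ n)).trans ?_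
    refine (Finset.sum_le_sum fun k _ => hshell k).trans ?_
    rw [← Finset.sum_mul, ← ENNReal.ofReal_sum_of_nonneg fun k _ => by positivity,
      ← Finset.mul_sum]
    gcongr
    exact hsum (n + 1)
  · refine ENNReal.mul_lt_top ENNReal.ofReal_lt_top (ENNReal.mul_lt_top (ENNReal.mul_lt_top ?_
      (ENNReal.add_lt_top.2 ⟨ENNReal.one_lt_top, (hD.ne_top y ρ).lt_top⟩)) hf.lt_top)
    exact ENNReal.pow_lt_top (by norm_num)

/-- Gaussian bounds at a common scale compose. The intermediate function `A₂ (χ_B f)` is cut off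
to balls, which the continuity of `A₁` along truncations permits, and then into pieces living in
balls of radius `ρ`; the two Gaussian factors of a piece leave decay both in `d(x, y)` and in the
distance from the piece to `x`, and the latter makes the sum over the pieces converge. -/
theorem comp (S : BanachFunctionSpace μ 𝔹) (hD : DoublingWith μ b) {p p₀ q : ℝ≥0∞} (hp : 1 ≤ p)
    (hpp₀ : p ≤ p₀) (hp₀q : p₀ ≤ q) (hC : 0 < C) (hc : 0 < c) :
    ∃ C' : ℝ, 0 < C' ∧ ∀ (ρ : ℝ) (A₁ A₂ : 𝔹 →L[ℂ] 𝔹), 0 < ρ → GaussBound S p₀ q ρ C c A₁ →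
      GaussBound S p p₀ ρ C c A₂ →
      (∀ g : 𝔹, MemLp (S.toFun g : X → ℂ) p μ → MemLp (S.toFun g : X → ℂ) p₀ μ →
        TruncContinuousAt S A₁ g) →
      GaussBound S p q ρ C' (c / 4) (A₁.comp A₂) := by
  obtain ⟨K, hK, hsum⟩ := exists_sum_dyadic_exp_le (4 * b) (c := c / 16) (by positivity)
  refine ⟨C ^ 2 * Real.exp (2 * c) * K, by positivity, fun ρ A₁ A₂ hρ h₁ h₂ hA x y f => ?_⟩
  have hp₀ : 1 ≤ p₀ := hp.trans hpp₀
  have hq : 1 ≤ q := hp₀.trans hp₀q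
  set N := ballAvg μ y ρ p (S.toFun f) with hN
  rcases eq_or_ne N ∞ with hNt | hNt
  · rw [hNt, ENNReal.mul_top (by
      rw [Ne, ENNReal.ofReal_eq_zero, not_le]; positivity)]
    exact le_top
  set g := A₂ (S.trunc (ball y ρ) f)
  have hcont : TruncContinuousAt S A₁ g := hA g
    ((h₂.mono_right hD hρ hpp₀).memLp hD hp hC.le hc hρ hNt)
    (h₂.memLp hD hp₀ hC.le hc hρ hNt)
  refine ballAvg_le_of_tendstoInMeasure (hcont x x ρ) fun n => ?_
  set D := dist x y / ρ with hDdef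
  -- From `D ≤ d(x, z) / ρ + d(z, y) / ρ`, half of the total Gaussian exponent yields decay in `D`;
  -- half of the factor in `d(x, z)` is kept to sum over the shells.
  have hpiece : ∀ k, ∀ Q ⊆ ball x (n : ℝ) ∩ dyadicShell x ρ k, MeasurableSet Q → Q.Nonempty →
      avgNorm μ (ball x ρ) (ball x ρ) q (S.toFun (A₁ (S.trunc Q g))) ≤
        ENNReal.ofReal (C ^ 2 * Real.exp (2 * c) * Real.exp (-(c / 4 * D ^ 2)) *
          ((2 ^ k) ^ (4 * b) * Real.exp (-(c / 16 * (2 ^ k) ^ 2)))) * N := by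
    intro k Q hQ hQm _
    obtain ⟨t, htc, htE, ht⟩ := hD.exists_cover hρ (dyadicShell_subset_ball x ρ k)
    refine (avgNorm_map_trunc_le_sum S A₁ g hq t (fun z => ball z ρ)
      (fun z => measurableSet_ball) (fun _ => ENNReal.ofReal (C ^ 2 * (Real.exp (2 * c) *
        Real.exp (-(c / 4 * D ^ 2)) * Real.exp (-(c / 16 * (2 ^ k) ^ 2)))) * N) hQm
        ((hQ.trans inter_subset_right).trans htE) ?_).trans ?_
    · intro z hz Q' hQ' hQm' _
      have hQz := hQ'.trans inter_subset_right
      refine (h₁.ballAvg_trunc_le (x := x) hQm' hQz g).trans ?_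
      refine (mul_le_mul' le_rfl ((avgNorm_mono subset_rfl hQz _).trans (h₂ z y f))).trans ?_
      rw [← mul_assoc, ← ENNReal.ofReal_mul (by positivity)]
      refine mul_le_mul' (ENNReal.ofReal_le_ofReal ?_) le_rfl
      rw [mul_mul_mul_comm, ← Real.exp_add, ← Real.exp_add, ← Real.exp_add, sq C]
      refine mul_le_mul_of_nonneg_left (Real.exp_le_exp.2 ?_) (by positivity)
      have h1 := two_pow_le_of_near_dyadicShell hρ (ht z hz)
      have h2 : (0 : ℝ) ≤ 2 ^ k := by positivity
      have h3 : 0 ≤ dist x z / ρ := by positivity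
      have h4 : ((2 : ℝ) ^ k) ^ 2 ≤ 8 * (dist x z / ρ) ^ 2 + 32 := by
        nlinarith [sq_nonneg (2 * (dist x z / ρ) - 4)]
      have h5 : D ≤ dist x z / ρ + dist z y / ρ := by
        rw [hDdef, ← add_div]
        gcongr
        exact dist_triangle x z y
      have h6 : 0 ≤ D := by positivity
      have h7 : D ^ 2 ≤ 2 * ((dist x z / ρ) ^ 2 + (dist z y / ρ) ^ 2) := by
        nlinarith [sq_nonneg (dist x z / ρ - dist z y / ρ)]
      have h8 : 0 ≤ (dist z y / ρ) ^ 2 := by positivity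
      nlinarith
    · rw [Finset.sum_const, nsmul_eq_mul, ← mul_assoc]
      gcongr
      calc (t.card : ℝ≥0∞) * ENNReal.ofReal (C ^ 2 * (Real.exp (2 * c) *
            Real.exp (-(c / 4 * D ^ 2)) * Real.exp (-(c / 16 * (2 ^ k) ^ 2))))
          ≤ ENNReal.ofReal ((2 ^ k) ^ (4 * b)) * ENNReal.ofReal (C ^ 2 * (Real.exp (2 * c) *
            Real.exp (-(c / 4 * D ^ 2)) * Real.exp (-(c / 16 * (2 ^ k) ^ 2)))) := by
            gcongr
            rw [← pow_mul, mul_comm k, ENNReal.ofReal_pow (by norm_num), ENNReal.ofReal_ofNat]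
            exact_mod_cast htc
        _ = _ := by
            rw [← ENNReal.ofReal_mul (by positivity)]
            ring_nf
  obtain ⟨m, hm⟩ := exists_two_pow_mul_gt (R := (n : ℝ)) hρ
  refine (avgNorm_map_trunc_le_sum S A₁ g hq (Finset.range (m + 1)) (dyadicShell x ρ)
    (measurableSet_dyadicShell x ρ) _ measurableSet_ball
    ((ball_subset_ball hm.le).trans (ball_subset_biUnion_dyadicShell x ρ m))
    fun k _ => hpiece k).trans ?_
  rw [← Finset.sum_mul, ← ENNReal.ofReal_sum_of_nonneg fun k _ => by positivity, ← Finset.mul_sum]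
  gcongr ENNReal.ofReal ?_ * N
  calc _ ≤ C ^ 2 * Real.exp (2 * c) * Real.exp (-(c / 4 * D ^ 2)) * K := by
        gcongr
        exact hsum (m + 1)
    _ = _ := by ring

end GaussBound

end

section

variable {X : Type*} [MetricSpace X] [MeasurableSpace X] [BorelSpace X] {μ : Measure X}
  {𝔹 : Type*} [NormedAddCommGroup 𝔹] [NormedSpace ℂ 𝔹]

/-! ### Off-diagonal estimates on balls and Gaussian bounds -/

theorem upsilon_pos {s : ℝ} (hs : 0 < s) : 0 < upsilon s := lt_max_of_lt_left hs

theorem one_le_upsilon {s : ℝ} (hs : 0 < s) : 1 ≤ upsilon s := by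
  rcases le_total 1 s with h | h
  · exact le_max_of_le_left h
  · exact le_max_of_le_right ((one_le_inv₀ hs).2 h)

theorem upsilon_two_mul_le {s : ℝ} (hs : 0 < s) : upsilon (2 * s) ≤ 2 * upsilon s := by
  refine max_le ?_ ?_
  · gcongr
    exact le_max_left _ _
  · have h1 : s⁻¹ ≤ upsilon s := le_max_right _ _
    have h2 : (2 * s)⁻¹ ≤ s⁻¹ := by
      gcongr
      linarith
    linarith [inv_pos.2 hs]

/-- Gaussian bounds at the scale of the square root of the time imply the off-diagonal estimates
on balls of every radius. -/
theorem offDiag_of_gaussBound (S : BanachFunctionSpace μ 𝔹) {b : ℕ} (hD : DoublingWith μ b)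
    {p q : ℝ≥0∞} (hp : 1 ≤ p) (hq : 1 ≤ q) {I : Type*} {τ : I → ℝ} {T : I → 𝔹 →L[ℂ] 𝔹}
    (hτ : ∀ i, 0 < τ i) {C c : ℝ} (hC : 0 < C) (hc : 0 < c)
    (h : ∀ i, GaussBound S p q (√(τ i)) C c (T i)) : OffDiag S p q τ T := by
  refine ⟨b + 1, (9 * b + 1 : ℕ), c / 8, 2 ^ (23 * b) * (C * Real.exp (4 * c)), by positivity,
    by positivity, by positivity, by positivity, fun i x r hr f _ => ?_⟩
  have hρ : 0 < √(τ i) := Real.sqrt_pos.2 (hτ i)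
  refine ⟨?_, fun j _ => ?_⟩
  · have h1 := (h i).avgNorm_le hD hp hq hC.le hc.le hρ hr (E := ball x r) (F := ball x r)
      measurableSet_ball subset_rfl subset_rfl le_rfl (fun _ _ _ _ => dist_nonneg) f
    refine h1.trans ?_
    have hU := one_le_upsilon (div_pos hr hρ)
    refine mul_le_mul' (ENNReal.ofReal_le_ofReal ?_) le_rfl
    rw [Real.rpow_natCast, zero_div, zero_pow two_ne_zero, mul_zero, neg_zero, Real.exp_zero,
      mul_one, mul_right_comm]
    gcongr ?_ * (C * Real.exp (4 * c)) * ?_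
    · exact pow_le_pow_right₀ one_le_two (by omega)
    · exact pow_le_pow_right₀ hU (by omega)
  · set R : ℝ := 2 ^ (j + 1) * r
    have hR : 0 < R := by positivity
    have hrR : r ≤ R := le_mul_of_one_le_left hr.le (one_le_pow₀ one_le_two)
    have hBR : ball x r ⊆ ball x R := ball_subset_ball hrR
    have hAR : annulus x r j ⊆ ball x R := sdiff_subset
    have hAm : MeasurableSet (annulus x r j) := measurableSet_ball.diff measurableSet_ball
    have hdist : ∀ e ∈ annulus x r j, ∀ y ∈ ball x r, 2 ^ j * r - r ≤ dist y e := by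
      intro e he y hy
      have h1 : ¬ dist e x < 2 ^ j * r := he.2
      have h2 := dist_triangle_left e x y
      have h3 := mem_ball.1 hy
      linarith
    have hδ : ∀ e ∈ annulus x r j, ∀ y ∈ ball x r, 2 ^ j * r / 2 ≤ dist y e := by
      intro e he y hy
      have h4 : (2 : ℝ) ^ 1 ≤ 2 ^ j := pow_le_pow_right₀ one_le_two (by omega)
      have h5 := mul_le_mul_of_nonneg_right h4 hr.le
      linarith [hdist e he y hy]
    have hδ0 : 0 ≤ 2 ^ j * r / 2 := by positivity
    have hu : 0 < 2 ^ j * r / √(τ i) := by positivity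
    have hU := one_le_upsilon hu
    have hU2 : upsilon (R / √(τ i)) ≤ 2 * upsilon (2 ^ j * r / √(τ i)) := by
      refine le_trans (le_of_eq ?_) (upsilon_two_mul_le hu)
      simp only [R]
      ring_nf
    have hU3 : 0 < upsilon (R / √(τ i)) := upsilon_pos (by positivity)
    have hexp : Real.exp (-(c / 2 * (2 ^ j * r / 2 / √(τ i)) ^ 2)) =
        Real.exp (-(c / 8 * 4 ^ j * r ^ 2 / τ i)) := by
      congr 2
      rw [div_pow, Real.sq_sqrt (hτ i).le, show (4 : ℝ) ^ j = (2 ^ j) ^ 2 by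
        rw [← pow_mul, mul_comm, pow_mul]; norm_num]
      ring
    have hpow : (2 : ℝ) ^ ((j : ℝ) * (b + 1)) = 2 ^ (j * (b + 1)) := by
      exact_mod_cast Real.rpow_natCast 2 (j * (b + 1))
    have hconst : (2 : ℝ) ^ (b * (j + 1)) * ((2 ^ (13 * b) * upsilon (R / √(τ i)) ^ (9 * b)) *
        (C * (Real.exp (4 * c) * Real.exp (-(c / 2 * (2 ^ j * r / 2 / √(τ i)) ^ 2))))) ≤
        2 ^ (23 * b) * (C * Real.exp (4 * c)) * ((2 : ℝ) ^ ((j : ℝ) * (b + 1)) *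
          upsilon (2 ^ j * r / √(τ i)) ^ ((9 * b + 1 : ℕ) : ℝ) *
            Real.exp (-(c / 8 * 4 ^ j * r ^ 2 / τ i))) := by
      rw [hexp, Real.rpow_natCast, hpow]
      calc _ ≤ (2 : ℝ) ^ (b * (j + 1)) *
            ((2 ^ (13 * b) * (2 * upsilon (2 ^ j * r / √(τ i))) ^ (9 * b)) *
              (C * (Real.exp (4 * c) * Real.exp (-(c / 8 * 4 ^ j * r ^ 2 / τ i))))) := by gcongr
        _ = 2 ^ (23 * b) * (C * Real.exp (4 * c)) * (2 ^ (j * b) *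
          upsilon (2 ^ j * r / √(τ i)) ^ (9 * b) *
            Real.exp (-(c / 8 * 4 ^ j * r ^ 2 / τ i))) := by ring
        _ ≤ _ := by
          gcongr ?_ * (?_ * ?_ * ?_)
          · exact pow_le_pow_right₀ one_le_two (Nat.mul_le_mul_left j (Nat.le_succ b))
          · exact pow_le_pow_right₀ hU (by omega)
    constructor
    · refine (avgNorm_le_mul (one_le_pow₀ one_le_two) hq subset_rfl (hD.ne_top x R)
        (hD.pow_le x hr (j + 1)) _).trans ?_
      refine (mul_le_mul' le_rfl ((h i).avgNorm_le hD hp hq hC.le hc.le hρ hR hAm hAR hBR hδ0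
        hδ f)).trans ?_
      rw [← mul_assoc, two_pow_mul_ofReal]
      exact mul_le_mul' (ENNReal.ofReal_le_ofReal hconst) le_rfl
    · refine ((h i).avgNorm_le hD hp hq hC.le hc.le hρ hR measurableSet_ball hBR hAR hδ0
        (fun e he y hy => by rw [dist_comm]; exact hδ y hy e he) f).trans ?_
      refine mul_le_mul' (ENNReal.ofReal_le_ofReal (le_trans ?_ hconst)) ?_
      · refine le_mul_of_one_le_left (by positivity) (one_le_pow₀ one_le_two)
      · exact avgNorm_mono hBR subset_rfl _

/-- If `s` and `ρ` are comparable, then `Υ(v ρ / s)` grows at most linearly in `v ≥ 1`. -/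
theorem upsilon_mul_div_le {l ρ s v : ℝ} (hl : 0 < l) (hρ : 0 < ρ) (hv : 1 ≤ v)
    (h1 : l * ρ ≤ s) (h2 : l * s ≤ ρ) : upsilon (v * ρ / s) ≤ v / l := by
  have hs : 0 < s := lt_of_lt_of_le (by positivity) h1
  have hv0 : 0 < v := by positivity
  refine max_le ?_ ?_
  · rw [div_le_div_iff₀ hs hl]
    nlinarith
  · rw [inv_div, div_le_div_iff₀ (by positivity) hl]
    have h3 : ρ ≤ v * v * ρ := by nlinarith [mul_le_mul hv hv zero_le_one hv0.le]
    nlinarith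

/-- Off-diagonal estimates on balls imply Gaussian bounds at every scale comparable to the square
root of the time. For nearby centres a larger ball containing both balls is used. For distant
centres `x`, `y` the radius `r'` and the index `j` are chosen with `2 ^ j r' = d(x, y) - ρ`, so
that the annulus `C_j(B(y, r'))` contains the whole ball `B(x, ρ)`. -/
theorem exists_gaussBound_of_offDiag (S : BanachFunctionSpace μ 𝔹) {b : ℕ}
    (hD : DoublingWith μ b) {p q : ℝ≥0∞} (hp : 1 ≤ p) (hq : 1 ≤ q) {I : Type*} {τ : I → ℝ}
    {T : I → 𝔹 →L[ℂ] 𝔹} (h : OffDiag S p q τ T) {l : ℝ} (hl : 0 < l) :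
    ∃ C c : ℝ, 0 < C ∧ 0 < c ∧ ∀ (i : I) (ρ : ℝ), 0 < ρ → l * ρ ≤ √(τ i) → l * √(τ i) ≤ ρ →
      GaussBound S p q ρ C c (T i) := by
  obtain ⟨θ₁, θ₂, c, C, hθ₁, hθ₂, hc, hC, h⟩ := h
  obtain ⟨N₁, hN₁⟩ := exists_nat_ge θ₁
  obtain ⟨N₂, hN₂⟩ := exists_nat_ge θ₂
  obtain ⟨K, hK, hexp⟩ := exists_pow_mul_exp_neg_sq_le_exp (b + N₁ + N₂) (c := c * l ^ 2)
    (by positivity)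
  set c' := c * l ^ 2 / 4
  have hc' : 0 < c' := by positivity
  set C₁ := 2 ^ (4 * b) * (C * (8 / l) ^ θ₂) * Real.exp (25 * c')
  set C₂ := 8 ^ b * C * (1 / l) ^ θ₂ * K
  have hC₁ : 0 < C₁ := by positivity
  have hC₂ : 0 < C₂ := by positivity
  refine ⟨C₁ + C₂, c', by positivity, hc', fun i ρ hρ hs1 hs2 x y f => ?_⟩
  set s := √(τ i) with hs
  have hs0 : 0 < s := lt_of_lt_of_le (by positivity) hs1
  have hτs : τ i = s ^ 2 := by rw [hs, Real.sq_sqrt (Real.sqrt_pos.1 hs0).le]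
  set N := ballAvg μ y ρ p (S.toFun f) with hN
  rcases eq_or_ne N ∞ with hNt | hNt
  · rw [hNt, ENNReal.mul_top (by
      rw [Ne, ENNReal.ofReal_eq_zero, not_le]; positivity)]
    exact le_top
  -- The estimates are applied to `χ_B f`, which lies in `L^p` although `f` need not.
  set F := S.trunc (ball y ρ) f
  have hF : MemLp (S.toFun F : X → ℂ) p μ := memLp_trunc_ball S hD hρ hp hNt
  have hFtrunc : ∀ r : ℝ, ρ ≤ r → S.trunc (ball y r) F = F := fun r hr => by
    rw [S.trunc_trunc measurableSet_ball measurableSet_ball,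
      inter_eq_right.2 (ball_subset_ball hr)]
  have hFavg : ∀ r : ℝ, ρ ≤ r → ballAvg μ y r p (S.toFun F) ≤ N := fun r hr => by
    rw [ballAvg, avgNorm_trunc S measurableSet_ball, inter_eq_right.2 (ball_subset_ball hr)]
    exact avgNorm_mono (ball_subset_ball hr) subset_rfl _
  -- The annuli `C_j(B)` start at `j = 2`, which forces `d(x, y) ≥ 5 ρ` in the second case.
  rcases lt_or_ge (dist x y) (5 * ρ) with hd | hd
  · have h8 : ρ ≤ 8 * ρ := by linarith
    have h1 := (h i y (8 * ρ) (by positivity) F hF).1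
    rw [hFtrunc _ h8, ← hs] at h1
    have hsub : ball x ρ ⊆ ball y (8 * ρ) := ball_subset_ball' (by linarith)
    refine (avgNorm_le_mul (one_le_pow₀ one_le_two) hq hsub
      (hD.ne_top y (8 * ρ)) (hD.le_pow_mul (y := x) hρ 4
        (by rw [dist_comm]; linarith)) _).trans ?_
    refine (mul_le_mul' le_rfl (h1.trans (mul_le_mul' le_rfl (hFavg _ h8)))).trans ?_
    rw [← mul_assoc, two_pow_mul_ofReal]
    refine mul_le_mul' (ENNReal.ofReal_le_ofReal ?_) le_rfl
    have h2 : upsilon (8 * ρ / s) ≤ 8 / l := upsilon_mul_div_le hl hρ (by norm_num) hs1 hs2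
    have h3 : 0 < upsilon (8 * ρ / s) := upsilon_pos (by positivity)
    have h4 : 1 ≤ Real.exp (25 * c') * Real.exp (-(c' * (dist x y / ρ) ^ 2)) := by
      rw [← Real.exp_add, Real.one_le_exp_iff]
      have h5 : dist x y / ρ ≤ 5 := ((div_lt_iff₀ hρ).2 hd).le
      have h6 : 0 ≤ dist x y / ρ := by positivity
      nlinarith [mul_le_mul h5 h5 h6 (by norm_num)]
    calc (2 : ℝ) ^ (b * 4) * (C * upsilon (8 * ρ / s) ^ θ₂)
        ≤ 2 ^ (4 * b) * (C * (8 / l) ^ θ₂) := by rw [mul_comm b]; gcongr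
      _ ≤ 2 ^ (4 * b) * (C * (8 / l) ^ θ₂) *
          (Real.exp (25 * c') * Real.exp (-(c' * (dist x y / ρ) ^ 2))) :=
          le_mul_of_one_le_right (by positivity) h4
      _ = C₁ * Real.exp (-(c' * (dist x y / ρ) ^ 2)) := by simp only [C₁]; ring
      _ ≤ _ := by gcongr; linarith
  · set u := (dist x y - ρ) / ρ with hu
    have huρ : u * ρ = dist x y - ρ := div_mul_cancel₀ _ hρ.ne'
    have hu4 : 4 ≤ u := by rw [hu, le_div_iff₀ hρ]; linarith
    obtain ⟨j, hj1, hj2⟩ := exists_nat_pow_near (show 1 ≤ u by linarith) one_lt_two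
    have hj : 2 ≤ j := by
      by_contra! hj
      have : (2 : ℝ) ^ (j + 1) ≤ 2 ^ 2 := pow_le_pow_right₀ one_le_two (by omega)
      linarith
    have h2j : (0 : ℝ) < 2 ^ j := by positivity
    set r := u * ρ / 2 ^ j with hr
    have hjr : 2 ^ j * r = u * ρ := mul_div_cancel₀ _ h2j.ne'
    have hjr' : 2 ^ (j + 1) * r = 2 * (u * ρ) := by rw [pow_succ']; linarith
    have hρr : ρ ≤ r := by
      rw [hr, le_div_iff₀ h2j, mul_comm]
      gcongr
    have hsub : ball x ρ ⊆ annulus y r j := by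
      intro z hz
      have h1 := mem_ball.1 hz
      refine ⟨?_, ?_⟩
      · rw [mem_ball, hjr', huρ]
        linarith [dist_triangle z x y]
      · rw [mem_ball, hjr, huρ, not_lt]
        linarith [dist_triangle_left x y z]
    have h1 := ((h i y r (by linarith) F hF).2 j hj).2
    rw [hFtrunc _ hρr, hjr, ← hs, hτs] at h1
    refine (avgNorm_le_mul (one_le_pow₀ one_le_two) hq hsub (hD.ne_top y (2 ^ (j + 1) * r))
      (hD.le_pow_mul (y := x) hρ (j + 3) ?_) _).trans ?_
    · rw [hjr', huρ, dist_comm y x]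
      have h2 : u * ρ ≤ 2 ^ (j + 1) * ρ := by gcongr
      have h3 : (2 : ℝ) ^ (j + 3) * ρ = 4 * (2 ^ (j + 1) * ρ) := by ring
      linarith
    refine (mul_le_mul' le_rfl (h1.trans (mul_le_mul' le_rfl (hFavg _ hρr)))).trans ?_
    rw [← mul_assoc, two_pow_mul_ofReal]
    refine mul_le_mul' (ENNReal.ofReal_le_ofReal ?_) le_rfl
    have hu1 : 1 ≤ u := by linarith
    have hu0 : 0 < u := by linarith
    have e1 : (2 : ℝ) ^ (b * (j + 3)) ≤ 8 ^ b * u ^ b := by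
      calc (2 : ℝ) ^ (b * (j + 3)) = (2 ^ 3) ^ b * (2 ^ j) ^ b := by
            rw [← pow_mul, ← pow_mul, ← pow_add]; ring_nf
        _ ≤ _ := by norm_num; gcongr
    have e2 : (2 : ℝ) ^ ((j : ℝ) * θ₁) ≤ u ^ N₁ := by
      rw [Real.rpow_mul zero_le_two, Real.rpow_natCast, ← Real.rpow_natCast u]
      calc ((2 : ℝ) ^ j) ^ θ₁ ≤ u ^ θ₁ := by gcongr
        _ ≤ u ^ (N₁ : ℝ) := Real.rpow_le_rpow_of_exponent_le hu1 hN₁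
    have e3 : upsilon (u * ρ / s) ^ θ₂ ≤ (1 / l) ^ θ₂ * u ^ N₂ := by
      have h3 : 0 < upsilon (u * ρ / s) := upsilon_pos (by positivity)
      calc upsilon (u * ρ / s) ^ θ₂ ≤ (u / l) ^ θ₂ := by
            gcongr
            exact upsilon_mul_div_le hl hρ hu1 hs1 hs2
        _ = (1 / l) ^ θ₂ * u ^ θ₂ := by
            rw [← Real.mul_rpow (by positivity) hu0.le]; ring_nf
        _ ≤ _ := by
            rw [← Real.rpow_natCast u]
            gcongr
    have e4 : Real.exp (-(c * 4 ^ j * r ^ 2 / s ^ 2)) ≤ Real.exp (-(c * l ^ 2 * u ^ 2)) := by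
      rw [Real.exp_le_exp, neg_le_neg_iff, le_div_iff₀ (by positivity)]
      have h3 : (4 : ℝ) ^ j * r ^ 2 = (u * ρ) ^ 2 := by
        rw [← hjr, mul_pow, ← pow_mul, mul_comm j, pow_mul]; norm_num
      have h4 : (l * s) ^ 2 ≤ ρ ^ 2 := by gcongr
      calc c * l ^ 2 * u ^ 2 * s ^ 2 = c * u ^ 2 * (l * s) ^ 2 := by ring
        _ ≤ c * u ^ 2 * ρ ^ 2 := by gcongr
        _ = c * 4 ^ j * r ^ 2 := by rw [mul_assoc c (4 ^ j), h3]; ring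
    have e5 : Real.exp (-(c * l ^ 2 / 2 * u ^ 2)) ≤ Real.exp (-(c' * (dist x y / ρ) ^ 2)) := by
      rw [Real.exp_le_exp, neg_le_neg_iff]
      have h3 : dist x y / ρ = u + 1 := by
        rw [hu, div_add_one hρ.ne']; ring_nf
      have h4 : (u + 1) ^ 2 ≤ 2 * u ^ 2 := by nlinarith
      rw [h3]
      calc c' * (u + 1) ^ 2 ≤ c' * (2 * u ^ 2) := by gcongr
        _ = _ := by simp only [c']; ring
    have h3 : 0 < upsilon (u * ρ / s) := upsilon_pos (by positivity)
    calc (2 : ℝ) ^ (b * (j + 3)) * (C * (2 ^ ((j : ℝ) * θ₁) * upsilon (u * ρ / s) ^ θ₂ *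
          Real.exp (-(c * 4 ^ j * r ^ 2 / s ^ 2))))
        ≤ 8 ^ b * u ^ b * (C * (u ^ N₁ * ((1 / l) ^ θ₂ * u ^ N₂) *
          Real.exp (-(c * l ^ 2 * u ^ 2)))) := by gcongr
      _ = 8 ^ b * C * (1 / l) ^ θ₂ *
          (u ^ (b + N₁ + N₂) * Real.exp (-(c * l ^ 2 * u ^ 2))) := by ring
      _ ≤ 8 ^ b * C * (1 / l) ^ θ₂ * (K * Real.exp (-(c * l ^ 2 / 2 * u ^ 2))) := by
          exact mul_le_mul_of_nonneg_left (hexp u hu0.le) (by positivity)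
      _ ≤ 8 ^ b * C * (1 / l) ^ θ₂ * (K * Real.exp (-(c' * (dist x y / ρ) ^ 2))) := by gcongr
      _ = C₂ * Real.exp (-(c' * (dist x y / ρ) ^ 2)) := by simp only [C₂]; ring
      _ ≤ _ := by gcongr; linarith

end

/-! ### Derivatives and sectors -/

section

variable {X : Type*} [MetricSpace X] [MeasurableSpace X] {μ : Measure X}
  {𝔹 : Type*} [NormedAddCommGroup 𝔹] [NormedSpace ℂ 𝔹]

namespace GaussBound

variable {S : BanachFunctionSpace μ 𝔹} {p q : ℝ≥0∞} {ρ C c : ℝ} {A : 𝔹 →L[ℂ] 𝔹}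

theorem add (hq : 1 ≤ q) (h : GaussBound S p q ρ C c A) (hC : 0 ≤ C) {B : 𝔹 →L[ℂ] 𝔹} {C' : ℝ}
    (h' : GaussBound S p q ρ C' c B) (hC' : 0 ≤ C') : GaussBound S p q ρ (C + C') c (A + B) := by
  intro x y f
  rw [add_apply, map_add]
  refine (avgNorm_add_le hq _ _).trans ((add_le_add (h x y f) (h' x y f)).trans ?_)
  rw [← add_mul, ← ENNReal.ofReal_add (by positivity) (by positivity), ← add_mul]

theorem const_smul (h : GaussBound S p q ρ C c A) (a : ℂ) :
    GaussBound S p q ρ (‖a‖ * C) c (a • A) := by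
  intro x y f
  rw [smul_apply, map_smul, ballAvg, avgNorm_const_smul, mul_assoc ‖a‖,
    ENNReal.ofReal_mul (norm_nonneg a), ofReal_norm, mul_assoc]
  exact mul_le_mul' le_rfl (h x y f)

theorem convex (S : BanachFunctionSpace μ 𝔹) (hq : 1 ≤ q) (hC : 0 ≤ C) :
    Convex ℝ {A : 𝔹 →L[ℂ] 𝔹 | GaussBound S p q ρ C c A} := by
  intro A hA B hB s t hs ht hst
  have h := add hq (const_smul hA (s : ℂ)) (by positivity) (const_smul hB (t : ℂ)) (by positivity)
  rw [Complex.norm_of_nonneg hs, Complex.norm_of_nonneg ht, ← add_mul, hst, one_mul,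
    Complex.coe_smul, Complex.coe_smul] at h
  exact h

theorem isClosed (S : BanachFunctionSpace μ 𝔹) :
    IsClosed {A : 𝔹 →L[ℂ] 𝔹 | GaussBound S p q ρ C c A} := by
  refine IsSeqClosed.isClosed fun u A hu hA x y f => ?_
  have h1 : Tendsto (fun n => u n (S.trunc (ball y ρ) f)) atTop
      (𝓝 (A (S.trunc (ball y ρ) f))) :=
    ((ContinuousLinearMap.apply ℂ 𝔹 (S.trunc (ball y ρ) f)).continuous.tendsto A).comp hA
  exact ballAvg_le_of_tendstoInMeasure (S.tendstoInMeasure _ _ h1 x ρ) fun n => hu n x y f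

/-- Cauchy's estimate for Gaussian bounds. By the Cauchy integral formula the derivative is `m !`
times an average over the circle of operators with Gaussian bounds, and such operators form a
closed convex set. -/
theorem iteratedDeriv [CompleteSpace 𝔹] (hq : 1 ≤ q) (hC : 0 ≤ C) {T : ℂ → 𝔹 →L[ℂ] 𝔹} {z : ℂ}
    {R : ℝ} (hR : 0 < R) (hT : DifferentiableOn ℂ T (closedBall z R))
    (h : ∀ ζ ∈ sphere z R, GaussBound S p q ρ C c (T ζ)) (m : ℕ) :
    GaussBound S p q ρ (m.factorial * ((R ^ m)⁻¹ * C)) c (iteratedDeriv m T z) := by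
  set g : ℂ → 𝔹 →L[ℂ] 𝔹 := fun ζ => ((ζ - z)⁻¹ ^ m) • T ζ
  have hgint : CircleIntegrable g z R := by
    refine ContinuousOn.circleIntegrable hR.le ?_
    have hinv : ContinuousOn (fun ζ : ℂ => (ζ - z)⁻¹ ^ m) (sphere z R) :=
      ContinuousOn.pow (ContinuousOn.inv₀ (by fun_prop) fun ζ hζ =>
        sub_ne_zero.2 (ne_of_mem_sphere hζ hR.ne')) m
    exact hinv.smul (hT.continuousOn.mono sphere_subset_closedBall)
  have heq : _root_.iteratedDeriv m T z = (m.factorial : ℂ) • Real.circleAverage g z R := by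
    have h1 := hT.circleIntegral_one_div_sub_center_pow_smul hR m
    have h2 : (fun ζ => (1 / (ζ - z) ^ (m + 1)) • T ζ) = fun ζ => (ζ - z)⁻¹ • g ζ := by
      ext1 ζ
      rw [smul_smul, one_div, ← inv_pow, pow_succ']
    rw [h2] at h1
    rw [Real.circleAverage_eq_circleIntegral hR.ne', h1, smul_smul, smul_smul]
    have h3 : (m.factorial : ℂ) ≠ 0 := by exact_mod_cast m.factorial_ne_zero
    have h4 : (m.factorial : ℂ) * (2 * Real.pi * Complex.I)⁻¹ *
        (2 * Real.pi * Complex.I / m.factorial) = 1 := by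
      rw [mul_assoc, inv_mul_eq_div, div_right_comm, div_self Complex.two_pi_I_ne_zero,
        mul_one_div_cancel h3]
    rw [h4, one_smul]
  have hmem : GaussBound S p q ρ ((R ^ m)⁻¹ * C) c (Real.circleAverage g z R) := by
    have hC' : 0 ≤ (R ^ m)⁻¹ * C := by positivity
    rw [Real.circleAverage_eq_intervalAverage]
    refine (convex S hq hC').set_average_mem (isClosed S) ?_ ?_ (ae_of_all _ fun θ => ?_) ?_
    · simp [Set.uIoc_of_le Real.two_pi_pos.le, Real.pi_pos]
    · rw [Set.uIoc_of_le Real.two_pi_pos.le]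
      exact measure_Ioc_lt_top.ne
    · have hζ : circleMap z R θ ∈ sphere z R := circleMap_mem_sphere z hR.le θ
      have h4 := const_smul (h _ hζ) ((circleMap z R θ - z)⁻¹ ^ m)
      rw [norm_pow, norm_inv, mem_sphere_iff_norm.1 hζ, inv_pow] at h4
      exact h4
    · rw [Set.uIoc_of_le Real.two_pi_pos.le]
      exact (intervalIntegrable_iff_integrableOn_Ioc_of_le Real.two_pi_pos.le).1 hgint
  rw [heq]
  have h5 := const_smul hmem (m.factorial : ℂ)
  rwa [Complex.norm_natCast] at h5

end GaussBound

end

/-- A sector contains, about each point `z` of a smaller sector, a disc of radius proportional to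
`‖z‖`. -/
theorem exists_closedBall_subset_sector {ϑ ϑ₁ : ℝ} (hϑ : ϑ < Real.pi / 2) (hϑ₁ϑ : ϑ₁ < ϑ) :
    ∃ ε : ℝ, 0 < ε ∧ ε ≤ 1 / 2 ∧ ∀ z ∈ sector ϑ₁, ∀ w : ℂ, ‖w - z‖ ≤ ε * ‖z‖ → w ∈ sector ϑ := by
  obtain ⟨δ, hδ, h⟩ := Metric.continuousAt_iff.1
    (Complex.continuousAt_arg Complex.one_mem_slitPlane) (ϑ - ϑ₁) (by linarith)
  refine ⟨min (1 / 2) (δ / 2), by positivity, min_le_left _ _, fun z hz w hw => ?_⟩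
  have hz0 : 0 < ‖z‖ := norm_pos_iff.2 hz.1
  set u := w / z
  have hwu : w = z * u := (mul_div_cancel₀ w hz.1).symm
  have hu : ‖u - 1‖ ≤ min (1 / 2) (δ / 2) := by
    rw [show u - 1 = (w - z) / z by rw [sub_div, div_self hz.1], norm_div, div_le_iff₀ hz0]
    exact hw
  have hu0 : u ≠ 0 := by
    intro h0
    rw [h0, zero_sub, norm_neg, norm_one] at hu
    linarith [hu.trans (min_le_left _ _)]
  have harg : |u.arg| < ϑ - ϑ₁ := by
    have h1 : dist u 1 < δ := by
      rw [dist_eq_norm]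
      linarith [hu.trans (min_le_right _ _)]
    have h2 := h h1
    rwa [Complex.arg_one, Real.dist_eq, sub_zero] at h2
  have hsum : |z.arg + u.arg| < ϑ := by
    linarith [abs_add_le z.arg u.arg, hz.2]
  have hpi := Real.pi_pos
  have hlt := abs_lt.1 hsum
  refine ⟨hwu ▸ mul_ne_zero hz.1 hu0, ?_⟩
  rw [hwu, Complex.arg_mul hz.1 hu0 ⟨by linarith, by linarith⟩]
  exact hsum

theorem mul_sqrt_le_sqrt {l s t : ℝ} (hl : 0 ≤ l) (h : l ^ 2 * s ≤ t) : l * √s ≤ √t := by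
  calc l * √s = √(l ^ 2 * s) := by rw [Real.sqrt_mul (sq_nonneg l), Real.sqrt_sq hl]
    _ ≤ √t := Real.sqrt_le_sqrt h

section

variable {X : Type*} [MetricSpace X] [MeasurableSpace X] [BorelSpace X] {μ : Measure X}
  {𝔹 : Type*} [NormedAddCommGroup 𝔹] [NormedSpace ℂ 𝔹]

/-- Near a point `z` of the smaller sector, `T_ζ` factors as `T_t T_w T_t` with `t > 0` and `w` in
the larger sector, all three times being comparable to `‖z‖`. The outer factors improve
integrability from `L^p` to `L^{p₀}` and from `L^{p₀}` to `L^q`. -/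
theorem exists_gaussBound_near_sector (S : BanachFunctionSpace μ 𝔹) {b : ℕ}
    (hD : DoublingWith μ b) {p p₀ q : ℝ≥0∞} (hp : 1 ≤ p) (hpp₀ : p ≤ p₀) (hp₀q : p₀ ≤ q)
    {ϑ ϑ₁ : ℝ} (hϑ0 : 0 < ϑ) {T : ℂ → 𝔹 →L[ℂ] 𝔹} (hT : IsAnalyticSemigroup ϑ T)
    (hTtrunc : ∀ z ∈ sector ϑ, ∀ f : 𝔹, MemLp (S.toFun f : X → ℂ) p μ →
      MemLp (S.toFun f : X → ℂ) p₀ μ → TruncContinuousAt S (T z) f)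
    (hreal : OffDiagReal S p q T) (hsector : OffDiagSector S p₀ p₀ ϑ T) {ε : ℝ} (hε : 0 < ε)
    (hε1 : ε ≤ 1 / 2)
    (hsub : ∀ z ∈ sector ϑ₁, ∀ w : ℂ, ‖w - z‖ ≤ ε * ‖z‖ → w ∈ sector ϑ) :
    ∃ C c : ℝ, 0 < C ∧ 0 < c ∧ ∀ z ∈ sector ϑ₁, ∀ ζ : ℂ, ‖ζ - z‖ ≤ ε / 2 * ‖z‖ →
      GaussBound S p q (√‖z‖) C c (T ζ) := by
  have hp₀ : 1 ≤ p₀ := hp.trans hpp₀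
  have hq : 1 ≤ q := hp₀.trans hp₀q
  obtain ⟨C₁, c₁, hC₁, hc₁, h₁⟩ := exists_gaussBound_of_offDiag S hD hp hq hreal
    (l := ε / 4) (by positivity)
  obtain ⟨C₂, c₂, hC₂, hc₂, h₂⟩ := exists_gaussBound_of_offDiag S hD hp₀ hp₀ hsector
    (l := ε / 4) (by positivity)
  set C := max C₁ C₂
  set c := min c₁ c₂
  have hC : 0 < C := lt_max_of_lt_left hC₁
  have hc : 0 < c := lt_min hc₁ hc₂
  obtain ⟨C₃, hC₃, h₃⟩ := GaussBound.comp S hD hp hpp₀ le_rfl hC hc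
  obtain ⟨C₄, hC₄, h₄⟩ := GaussBound.comp S hD hp hpp₀ hp₀q (C := max C₃ C) (c := c / 4)
    (lt_max_of_lt_left hC₃) (by positivity)
  refine ⟨C₄, c / 4 / 4, hC₄, by positivity, fun z hz ζ hζ => ?_⟩
  have hz0 : 0 < ‖z‖ := norm_pos_iff.2 hz.1
  have hρ : 0 < √‖z‖ := Real.sqrt_pos.2 hz0
  -- With `t = ε ‖z‖ / 4`, both `w = ζ - 2 t` and `w + t` stay within `ε ‖z‖` of `z`.
  set t : ℝ := ε / 4 * ‖z‖
  have ht : 0 < t := by positivity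
  have hnt : ‖(t : ℂ)‖ = t := Complex.norm_of_nonneg ht.le
  set w : ℂ := ζ - 2 * t
  have hwz : ‖w - z‖ ≤ ε * ‖z‖ := by
    calc ‖w - z‖ = ‖(ζ - z) - 2 * (t : ℂ)‖ := by simp only [w]; ring_nf
      _ ≤ ‖ζ - z‖ + ‖2 * (t : ℂ)‖ := norm_sub_le _ _
      _ ≤ ε / 2 * ‖z‖ + 2 * t := by
        rw [norm_mul, hnt, Complex.norm_ofNat]
        gcongr
      _ = ε * ‖z‖ := by simp only [t]; ring
  have hwtz : ‖w + t - z‖ ≤ ε * ‖z‖ := by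
    calc ‖w + t - z‖ = ‖(ζ - z) - (t : ℂ)‖ := by simp only [w]; ring_nf
      _ ≤ ‖ζ - z‖ + ‖(t : ℂ)‖ := norm_sub_le _ _
      _ ≤ ε / 2 * ‖z‖ + t := by
        rw [hnt]
        gcongr
      _ ≤ ε * ‖z‖ := by
        simp only [t]
        nlinarith [mul_pos hε hz0]
  have hw : w ∈ sector ϑ := hsub z hz w hwz
  have hwt : w + t ∈ sector ϑ := hsub z hz _ hwtz
  have hts : (t : ℂ) ∈ sector ϑ := by
    refine ⟨by exact_mod_cast ht.ne', ?_⟩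
    rw [Complex.arg_ofReal_of_nonneg ht.le, abs_zero]
    exact hϑ0
  have hfac : T ζ = (T t).comp ((T w).comp (T t)) := by
    rw [hT.comp w hw t hts, hT.comp t hts _ hwt]
    congr 1
    simp only [w]
    ring
  have hl : (ε / 4) ^ 2 ≤ 1 / 64 := by nlinarith
  have hlz : (ε / 4) ^ 2 * ‖z‖ ≤ 1 / 64 * ‖z‖ := by gcongr
  have hεz : ε * ‖z‖ ≤ 1 / 2 * ‖z‖ := by gcongr
  have hw1 : ‖z‖ / 2 ≤ ‖w‖ := by
    have h5 := norm_sub_norm_le z w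
    rw [norm_sub_rev z w] at h5
    linarith
  have hw2 : ‖w‖ ≤ 2 * ‖z‖ := by
    have h5 := norm_sub_norm_le w z
    linarith
  have hlw : (ε / 4) ^ 2 * ‖w‖ ≤ 1 / 64 * ‖w‖ := by gcongr
  have htz : t ≤ ‖z‖ := by simp only [t]; nlinarith
  have hlt : (ε / 4) ^ 2 * t ≤ 1 / 64 * t := by gcongr
  have hlt' : (ε / 4) ^ 2 * ‖z‖ ≤ t := by
    simp only [t]
    gcongr
    nlinarith
  have hGt : GaussBound S p q (√‖z‖) C c (T t) :=
    (h₁ ⟨t, ht⟩ (√‖z‖) hρ (mul_sqrt_le_sqrt (by positivity) hlt')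
      (mul_sqrt_le_sqrt (by positivity) (by linarith))).mono (le_max_left _ _) hC.le
        (min_le_left _ _)
  have hGw : GaussBound S p₀ p₀ (√‖z‖) C c (T w) :=
    (h₂ ⟨w, hw⟩ (√‖z‖) hρ (mul_sqrt_le_sqrt (by positivity) (by linarith))
      (mul_sqrt_le_sqrt (by positivity) (by linarith))).mono (le_max_right _ _) hC.le
        (min_le_right _ _)
  have h5 := h₃ (√‖z‖) (T w) (T t) hρ hGw (hGt.mono_right hD hρ hp₀q) (hTtrunc w hw)
  rw [hfac]
  exact h₄ (√‖z‖) (T t) _ hρ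
    ((hGt.mono_left hD hρ hpp₀).mono (le_max_right _ _) (hC.le.trans (le_max_right _ _))
      (by linarith))
    (h5.mono (le_max_left _ _) (hC.le.trans (le_max_right _ _)) le_rfl) (hTtrunc t hts)

end

end OffDiagonal

theorem mainTheorem7 {X : Type*} [MetricSpace X] [MeasurableSpace X] [BorelSpace X]
    (μ : Measure X) (hμ : OffDiagonal.IsHomogeneousType μ)
    {𝔹 : Type*} [NormedAddCommGroup 𝔹] [NormedSpace ℂ 𝔹] [CompleteSpace 𝔹]
    (S : OffDiagonal.BanachFunctionSpace μ 𝔹)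
    (p p₀ q : ℝ≥0∞) (hp : 1 ≤ p) (hpp₀ : p ≤ p₀) (hp₀q : p₀ ≤ q)
    (ϑ ϑ₁ : ℝ) (hϑ : ϑ < Real.pi / 2) (hϑ₁ : 0 ≤ ϑ₁) (hϑ₁ϑ : ϑ₁ < ϑ)
    (T : ℂ → 𝔹 →L[ℂ] 𝔹) (hT : OffDiagonal.IsAnalyticSemigroup ϑ T)
    (hTtrunc : ∀ z ∈ OffDiagonal.sector ϑ, ∀ f : 𝔹,
      MemLp (S.toFun f : X → ℂ) p μ → MemLp (S.toFun f : X → ℂ) p₀ μ →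
        OffDiagonal.TruncContinuousAt S (T z) f)
    (hreal : OffDiagonal.OffDiagReal S p q T)
    (hsector : OffDiagonal.OffDiagSector S p₀ p₀ ϑ T) (m : ℕ) :
    OffDiagonal.OffDiagSector S p q ϑ₁ (fun z => z ^ m • iteratedDeriv m T z) := by
  open OffDiagonal in
  rcases hμ.eq_zero_or_doublingWith with rfl | ⟨b, hD⟩
  · -- For `μ = 0` every averaged norm vanishes.
    exact ⟨1, 1, 1, 1, one_pos, one_pos, one_pos, one_pos, fun i x r hr f _ =>
      ⟨by simp [ballAvg, avgNorm], fun j _ =>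
        ⟨by simp [ballAvg, avgNorm], by simp [annulusAvg, avgNorm]⟩⟩⟩
  have hq : 1 ≤ q := (hp.trans hpp₀).trans hp₀q
  obtain ⟨ε, hε, hε1, hsub⟩ := exists_closedBall_subset_sector hϑ hϑ₁ϑ
  obtain ⟨C, c, hC, hc, h⟩ := exists_gaussBound_near_sector S hD hp hpp₀ hp₀q
    (hϑ₁.trans_lt hϑ₁ϑ) hT hTtrunc hreal hsector hε hε1 hsub
  refine offDiag_of_gaussBound S hD hp hq (fun z => norm_pos_iff.2 z.2.1)
    (C := m.factorial * ((2 / ε) ^ m * C)) (c := c) (by positivity) hc fun z => ?_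
  have hz0 : 0 < ‖(z : ℂ)‖ := norm_pos_iff.2 z.2.1
  have hd : DifferentiableOn ℂ T (closedBall (z : ℂ) (ε / 2 * ‖(z : ℂ)‖)) := fun ζ hζ =>
    (hT.analytic ζ (hsub z z.2 ζ ((mem_closedBall_iff_norm.1 hζ).trans (by
      gcongr; linarith)))).differentiableAt.differentiableWithinAt
  have h1 := (GaussBound.iteratedDeriv hq hC.le (by positivity) hd
    (fun ζ hζ => h z z.2 ζ (mem_sphere_iff_norm.1 hζ).le) m).const_smul ((z : ℂ) ^ m)
  convert h1 using 1
  rw [norm_pow, mul_pow, div_pow, div_pow]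
  field_simp
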